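/- Let $n\in\mathbb N$, $0<\lambda\le\Lambda$, and let $A:\mathbb R^n\to\mathbb R^{n\times n}$ be measurable with $A(x)$ symmetric and $\lambda|\xi|^2\le\langle A(x)\xi,\xi\rangle\le\Lambda|\xi|^2$ for almost every $x\in\mathbb R^n$ and every $\xi\in\mathbb R^n$. Let $f:\mathbb R\to[0,\infty)$ be nondecreasing (jumps are allowed), and put $F(t)=\int_0^t f(s)\,ds$ for $t\in\mathbb R$. Suppose that $u\in W^{1,2}_{\mathrm{loc}}(\mathbb R^n)$ is continuous, not constant, and a weak subsolution of $$\operatorname{div}(A(x)Du)\ge f(u)\quad\text{in }\mathbb R^n,$$ that is, for every bounded open set $U\subset\mathbb R^n$ we have $u\in W^{1,2}(U)$ and $\int_U\langle A\,Du,D\varphi\rangle\,dx\le-\int_U f(u)\varphi\,dx$ for all nonnegative $\varphi\in W^{1,2}_0(U)$. Then the Keller–Osserman condition holds in the following form (with $1/\sqrt{0}=\infty$). (a) For every real $b<\sup_{\mathbb R^n}u$, $$\int_b^\infty\frac{dt}{\sqrt{F(t)-F(b)}}=\infty .$$ (For $b=0$, if $\sup u>0$, this is $\int_0^\infty dt/\sqrt{F(t)}=\infty$.)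 (b) If $f(t_0)>0$ for some $t_0<\sup_{\mathbb R^n}u$ (for example, if $f$ is positive everywhere), then $$\int_a^\infty\frac{dt}{\sqrt{F(t)}}=\infty\qquad\text{for every }a\ge0 .$$ -/

import Mathlib

open MeasureTheory Filter Topology Set
open scoped ContDiff ENNReal

namespace DivForm

/-- The space `ℝⁿ` with its Euclidean norm. -/
abbrev Rn (n : ℕ) : Type := EuclideanSpace ℝ (Fin n)

/-- `ψ ∈ C_c^∞(U)`. -/
def IsTest {n : ℕ} (U : Set (Rn n)) (ψ : Rn n → ℝ) : Prop :=
  ContDiff ℝ ∞ ψ ∧ HasCompactSupport ψ ∧ tsupport ψ ⊆ U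

/-- `u ∈ W^{1,2}(U)` with weak gradient `Du` (for `U` open): both are square integrable on `U`, and
`∫_U u ∂_v ψ = - ∫_U ψ ⟨Du, v⟩` for all test functions `ψ` and all directions `v`. -/
def MemW12 {n : ℕ} (U : Set (Rn n)) (u : Rn n → ℝ) (Du : Rn n → Rn n) : Prop :=
  MemLp u 2 (volume.restrict U) ∧ MemLp Du 2 (volume.restrict U) ∧
    ∀ ψ : Rn n → ℝ, IsTest U ψ → ∀ v : Rn n,
      ∫ x in U, u x * fderiv ℝ ψ x v = -∫ x in U, ψ x * inner ℝ (Du x) v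

/-- `φ ∈ W_0^{1,2}(U)` with weak gradient `Dφ`: the function `φ` belongs to the closure of
`C_c^∞(U)` in `W^{1,2}(U)`. -/
def MemW120 {n : ℕ} (U : Set (Rn n)) (φ : Rn n → ℝ) (Dφ : Rn n → Rn n) : Prop :=
  MemW12 U φ Dφ ∧ ∃ ψ : ℕ → Rn n → ℝ, (∀ k, IsTest U (ψ k)) ∧
    Tendsto (fun k => eLpNorm (fun x => ψ k x - φ x) 2 (volume.restrict U)) atTop (𝓝 0) ∧
    Tendsto (fun k => eLpNorm (fun x => gradient (ψ k) x - Dφ x) 2 (volume.restrict U))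
      atTop (𝓝 0)

/-- The coefficient matrix `A` is measurable, and for almost every `x` it is symmetric with
`lam |ξ|² ≤ ⟨A(x) ξ, ξ⟩ ≤ Lam |ξ|²` for all `ξ`. -/
def IsUniformlyElliptic {n : ℕ} (A : Rn n → Matrix (Fin n) (Fin n) ℝ) (lam Lam : ℝ) : Prop :=
  (∀ i j, Measurable fun x => A x i j) ∧
    ∀ᵐ x, (A x).IsSymm ∧ ∀ ξ : Rn n,
      lam * ‖ξ‖ ^ 2 ≤ inner ℝ (Matrix.toEuclideanLin (A x) ξ) ξ ∧
      inner ℝ (Matrix.toEuclideanLin (A x) ξ) ξ ≤ Lam * ‖ξ‖ ^ 2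

/-- `u ∈ W^{1,2}(U)` is a weak subsolution of `div (A Du) = f(u)` in the open set `U`, that is,
`div (A Du) ≥ f(u)`: for all nonnegative `φ ∈ W_0^{1,2}(U)` the function `f(u) φ` is integrable
on `U` and `∫_U ⟨A Du, Dφ⟩ ≤ - ∫_U f(u) φ`. (The integrability is automatic if `u` is continuous
on the compact closure of `U` and `f` is monotone.) -/
def IsSubsolution {n : ℕ} (A : Rn n → Matrix (Fin n) (Fin n) ℝ) (f : ℝ → ℝ) (U : Set (Rn n))
    (u : Rn n → ℝ) : Prop :=
  ∃ Du : Rn n → Rn n, MemW12 U u Du ∧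
    ∀ (φ : Rn n → ℝ) (Dφ : Rn n → Rn n), MemW120 U φ Dφ →
      (∀ᵐ x ∂(volume.restrict U), 0 ≤ φ x) →
      IntegrableOn (fun x => f (u x) * φ x) U ∧
      ∫ x in U, inner ℝ (Matrix.toEuclideanLin (A x) (Du x)) (Dφ x) ≤
        -∫ x in U, f (u x) * φ x

/-- `u ∈ W^{1,2}_loc(ℝⁿ)` is a subsolution in the whole space: on every bounded open set it is in
`W^{1,2}` and a subsolution there. -/
def IsEntireSubsolution {n : ℕ} (A : Rn n → Matrix (Fin n) (Fin n) ℝ) (f : ℝ → ℝ)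
    (u : Rn n → ℝ) : Prop :=
  ∀ U : Set (Rn n), IsOpen U → Bornology.IsBounded U → IsSubsolution A f U u

/-- The integral function `F(t) = ∫_0^t f(s) ds`. -/
noncomputable def integralFunction (f : ℝ → ℝ) (t : ℝ) : ℝ := ∫ s in (0 : ℝ)..t, f s

/-- `1 / √y` as an extended nonnegative number, equal to `∞` at `y = 0`.
It is used for nonnegative `y` only. -/
noncomputable def invSqrt (y : ℝ) : ℝ≥0∞ := (ENNReal.ofReal (Real.sqrt y))⁻¹

end DivForm

namespace DivForm

open scoped Convolution Pointwise NNReal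

variable {n : ℕ} {E : Type*} [NormedAddCommGroup E] [NormedSpace ℝ E]

/-! A subsolution that attains a level must attain a higher one nearby. If the Keller–Osserman
integral converged, the distances needed for all these climbs would have a finite sum, and `u` would
be unbounded on a bounded ball, contradicting continuity.

The local ingredient is `exists_growth_const`: if `u ≤ M` on a ball of radius `δ` and `f (M - h) * δ
^ 2` is at least a constant times `h`, then `u ≤ M - h / 4` at the centre. Testing with `η²` times a
smoothed `(u - k)₊` gives a Caccioppoli inequality (`caccioppoli`) that keeps the term with `f`.
That term makes `{u > M - h / 2}` occupy a small fraction of the half ball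
(`exists_levelVol_rhs_bound`). De Giorgi's iteration, whose step `exists_levelVol_step` combines
Caccioppoli with the Sobolev inequality in `W^{1,1}`, turns small measure into a pointwise bound.
Only the monotonicity of `f` enters, so jumps are harmless.

Read contrapositively (`exists_reach`), a climb by `h / 4` from level `t` costs a distance of order
`√(h / f (t - h))`. Take levels `t k` with `F (t k) - F b = 4 ^ k γ²` and gaps `σ k`. Passing
through all levels costs at most a multiple of `∑ 2⁻ᵏ σ k`, and the tails of this series are
dominated by the Keller–Osserman integral (`lintegral_invSqrt_eq_top_of_pos`). This settles the case
`f > 0` beyond `b`. Otherwise `F` is constant just above `b` and the integrand is infinite there.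
Part (b) follows because `F` and `F - F b` are comparable at infinity. -/

/-! ### Mollification and smooth approximation of Sobolev functions -/

/-- Cauchy–Schwarz for `√ρ` and `√ρ · w`, which is Jensen's inequality for the probability density
`ρ`. -/
lemma sq_lintegral_mul_le {α : Type*} [MeasurableSpace α] {μ : Measure α} {ρ w : α → ℝ≥0∞}
    (hρ : AEMeasurable ρ μ) (hw : AEMeasurable w μ) (h1 : ∫⁻ x, ρ x ∂μ = 1) :
    (∫⁻ x, ρ x * w x ∂μ) ^ 2 ≤ ∫⁻ x, ρ x * w x ^ 2 ∂μ := by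
  have h := ENNReal.lintegral_mul_le_Lp_mul_Lq μ (p := 2) (q := 2) (by constructor <;> norm_num)
    (f := fun x => ρ x ^ (1 / 2 : ℝ)) (g := fun x => ρ x ^ (1 / 2 : ℝ) * w x)
    (by fun_prop) (by fun_prop)
  have e1 : ∀ y : ℝ≥0∞, (y ^ (1 / 2 : ℝ)) ^ (2 : ℝ) = y := fun y => by
    rw [← ENNReal.rpow_mul]; norm_num
  have e2 : ∀ x, ρ x ^ (1 / 2 : ℝ) * (ρ x ^ (1 / 2 : ℝ) * w x) = ρ x * w x := fun x => by
    rw [← mul_assoc, ← ENNReal.rpow_add_of_nonneg _ _ (by norm_num) (by norm_num)]; norm_num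
  simp only [Pi.mul_apply, ENNReal.mul_rpow_of_nonneg _ _ (zero_le_two : (0 : ℝ) ≤ 2), e1, e2, h1,
    ENNReal.one_rpow, one_mul] at h
  calc (∫⁻ x, ρ x * w x ∂μ) ^ 2 ≤ ((∫⁻ x, ρ x * w x ^ (2 : ℝ) ∂μ) ^ (1 / 2 : ℝ)) ^ 2 := by gcongr
    _ = ∫⁻ x, ρ x * w x ^ 2 ∂μ := by
      rw [← ENNReal.rpow_natCast, Nat.cast_ofNat, e1]; simp

lemma eLpNorm_two_sq {α G : Type*} [NormedAddCommGroup G] [MeasurableSpace α] {μ : Measure α}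
    (w : α → G) :
    eLpNorm w 2 μ ^ 2 = ∫⁻ x, ‖w x‖ₑ ^ 2 ∂μ := by
  have := eLpNorm_nnreal_pow_eq_lintegral (μ := μ) (f := w) (p := 2) (by norm_num)
  simpa using this

/-- Young's inequality for a kernel of mass one: Jensen pointwise, then Tonelli and translation
invariance. -/
lemma eLpNorm_convolution_le {ρ : Rn n → ℝ} {W : Rn n → E} (hρc : Continuous ρ)
    (hρ : ∀ x, 0 ≤ ρ x) (hρs : HasCompactSupport ρ) (h1 : ∫ x, ρ x = 1)
    (hW : AEStronglyMeasurable W volume) :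
    eLpNorm (ρ ⋆[ContinuousLinearMap.lsmul ℝ ℝ, volume] W) 2 volume ≤ eLpNorm W 2 volume := by
  have hρ1 : ∫⁻ x, ENNReal.ofReal (ρ x) = 1 := by
    rw [← ofReal_integral_eq_lintegral_ofReal (hρc.integrable_of_hasCompactSupport hρs)
      (ae_of_all _ hρ), h1, ENNReal.ofReal_one]
  have key : eLpNorm (ρ ⋆[ContinuousLinearMap.lsmul ℝ ℝ, volume] W) 2 volume ^ 2
      ≤ eLpNorm W 2 volume ^ 2 := by
    rw [eLpNorm_two_sq, eLpNorm_two_sq]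
    have hmeas : AEStronglyMeasurable (fun p : Rn n × Rn n => W (p.1 - p.2))
        (volume.prod volume) :=
      hW.comp_quasiMeasurePreserving (quasiMeasurePreserving_sub_of_right_invariant _ _)
    have hm1 : AEMeasurable (fun p : Rn n × Rn n => ENNReal.ofReal (ρ p.2) * ‖W (p.1 - p.2)‖ₑ ^ 2)
        (volume.prod volume) := by
      refine AEMeasurable.mul ?_ (hmeas.enorm.pow_const 2)
      exact (hρc.comp continuous_snd).measurable.ennreal_ofReal.aemeasurable
    calc ∫⁻ x, ‖(ρ ⋆[ContinuousLinearMap.lsmul ℝ ℝ, volume] W) x‖ₑ ^ 2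
        ≤ ∫⁻ x, ∫⁻ t, ENNReal.ofReal (ρ t) * ‖W (x - t)‖ₑ ^ 2 := by
          refine lintegral_mono fun x => ?_
          have hx : AEStronglyMeasurable (fun t => W (x - t)) volume :=
            hW.comp_quasiMeasurePreserving (quasiMeasurePreserving_sub_left_of_right_invariant _ x)
          refine le_trans ?_ (sq_lintegral_mul_le hρc.measurable.ennreal_ofReal.aemeasurable
            hx.enorm hρ1)
          gcongr
          refine (enorm_integral_le_lintegral_enorm _).trans_eq (lintegral_congr fun t => ?_)
          simp [enorm_smul, Real.enorm_eq_ofReal (hρ t)]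
      _ = ∫⁻ t, ∫⁻ x, ENNReal.ofReal (ρ t) * ‖W (x - t)‖ₑ ^ 2 := lintegral_lintegral_swap hm1
      _ = ∫⁻ t, ENNReal.ofReal (ρ t) * ∫⁻ x, ‖W x‖ₑ ^ 2 := by
          refine lintegral_congr fun t => ?_
          rw [lintegral_const_mul' _ _ ENNReal.ofReal_ne_top]
          congr 1
          exact lintegral_sub_right_eq_self (fun x => ‖W x‖ₑ ^ 2) t
      _ = ∫⁻ x, ‖W x‖ₑ ^ 2 := by
          rw [lintegral_mul_const _ hρc.measurable.ennreal_ofReal, hρ1, one_mul]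
  exact (ENNReal.pow_le_pow_left_iff two_ne_zero).1 key

/-- Convolution is an `L²` contraction, so it suffices to treat a continuous compactly supported `g`
close to `W`; for `g` the convergence is uniform. -/
lemma tendsto_eLpNorm_mollify [CompleteSpace E] {φ : ℕ → ContDiffBump (0 : Rn n)}
    (hφ : Tendsto (fun j => (φ j).rOut) atTop (𝓝 0)) {W : Rn n → E} (hW : MemLp W 2 volume) :
    Tendsto (fun j => eLpNorm (fun x => ((φ j).normed volume
      ⋆[ContinuousLinearMap.lsmul ℝ ℝ, volume] W) x - W x) 2 volume) atTop (𝓝 0) := by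
  rw [ENNReal.tendsto_nhds_zero]
  intro ε hε
  obtain ⟨δ, hδ0, hδ⟩ : ∃ δ : ℝ≥0, δ ≠ 0 ∧ (δ : ℝ≥0∞) * 3 ≤ ε := by
    obtain ⟨δ, hδ0, hδ⟩ := ENNReal.lt_iff_exists_nnreal_btwn.1 hε
    refine ⟨δ / 3, ?_, ?_⟩
    · simpa using (ENNReal.coe_pos.1 hδ0).ne'
    · rw [ENNReal.coe_div (by norm_num)]
      simp only [ENNReal.coe_ofNat]
      rw [ENNReal.div_mul_cancel (by norm_num) (by norm_num)]
      exact hδ.le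
  obtain ⟨g, hgs, hgW, hgc, hgL⟩ := hW.exists_hasCompactSupport_eLpNorm_sub_le (by norm_num)
    (ENNReal.coe_ne_zero.2 hδ0)
  -- For mollification radii below 1, both `g` and its mollification vanish off `K`, so a uniform
  -- bound becomes an `L²` bound with the finite factor `volume K ^ (1 / 2)`.
  set K := Metric.cthickening 1 (tsupport g) with hK
  have hKc : IsCompact K := hgs.isCompact.cthickening
  obtain ⟨η, hη0, hη⟩ : ∃ η : ℝ≥0, η ≠ 0 ∧ volume K ^ (1 / 2 : ℝ) * η ≤ δ := by
    have hfin : volume K ^ (1 / 2 : ℝ) ≠ (⊤ : ℝ≥0∞) :=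
      ENNReal.rpow_ne_top_of_nonneg (by norm_num) hKc.measure_lt_top.ne
    lift volume K ^ (1 / 2 : ℝ) to ℝ≥0 using hfin with c hc
    refine ⟨δ / (c + 1), by positivity, ?_⟩
    rw [← ENNReal.coe_mul]
    refine ENNReal.coe_le_coe.2 ?_
    rw [mul_div_assoc', div_le_iff₀ (by positivity), mul_comm]
    gcongr
    simp
  have huc := hgs.uniformContinuous_of_continuous hgc
  rw [Metric.uniformContinuous_iff] at huc
  obtain ⟨r, hr, hgr⟩ := huc η (by positivity)
  filter_upwards [hφ.eventually_lt_const (lt_min hr one_pos)] with j hj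
  set ρ := (φ j).normed volume with hρ
  have hρc : Continuous ρ := (φ j).continuous_normed
  have hρs : HasCompactSupport ρ := (φ j).hasCompactSupport_normed
  have hg0 : ∀ x, x ∉ K → g x = 0 := fun x hx =>
    image_eq_zero_of_notMem_tsupport fun h => hx (Metric.self_subset_cthickening _ h)
  have hbd : ∀ x, ‖(ρ ⋆[ContinuousLinearMap.lsmul ℝ ℝ, volume] g) x - g x‖ ≤ η := fun x => by
    rw [← dist_eq_norm]
    refine (φ j).dist_normed_convolution_le hgc.aestronglyMeasurable fun y hy => ?_
    exact (hgr ((Metric.mem_ball.1 hy).trans (hj.trans_le (min_le_left _ _)))).le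
  have hsupp : ∀ x, x ∉ K → (ρ ⋆[ContinuousLinearMap.lsmul ℝ ℝ, volume] g) x - g x = 0 := by
    intro x hx
    have : (ρ ⋆[ContinuousLinearMap.lsmul ℝ ℝ, volume] g) x = g x := by
      refine (φ j).normed_convolution_eq_right fun y hy => ?_
      rw [hg0 x hx]
      refine image_eq_zero_of_notMem_tsupport fun h => hx ?_
      refine Metric.mem_cthickening_of_dist_le x y 1 _ h ?_
      rw [dist_comm]
      exact ((Metric.mem_ball.1 hy).trans (hj.trans_le (min_le_right _ _))).le
    rw [this, sub_self]
  have hmid : eLpNorm (fun x => (ρ ⋆[ContinuousLinearMap.lsmul ℝ ℝ, volume] g) x - g x) 2 volume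
      ≤ δ := by
    rw [← eLpNorm_restrict_eq_of_support_subset (s := K) (fun x hx => by
      by_contra h; exact hx (hsupp x h))]
    refine (eLpNorm_le_of_ae_bound (C := η) (ae_of_all _ hbd)).trans ?_
    simpa using hη
  have hWl : LocallyIntegrable W volume := hW.locallyIntegrable (by norm_num)
  have hfirst := eLpNorm_convolution_le hρc (fun x => (φ j).nonneg_normed x) hρs
    (φ j).integral_normed (hW.sub hgL).aestronglyMeasurable
  have hconv : ∀ x, (ρ ⋆[ContinuousLinearMap.lsmul ℝ ℝ, volume] (W - g)) x =
      (ρ ⋆[ContinuousLinearMap.lsmul ℝ ℝ, volume] W) x -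
      (ρ ⋆[ContinuousLinearMap.lsmul ℝ ℝ, volume] g) x := fun x => by
    have e1 := hρs.convolutionExists_left (ContinuousLinearMap.lsmul ℝ ℝ) hρc hWl x
    have e2 := hρs.convolutionExists_left (ContinuousLinearMap.lsmul ℝ ℝ) hρc
      (hgc.locallyIntegrable (μ := volume)) x
    simp only [convolution, Pi.sub_apply, map_sub]
    exact integral_sub e1 e2
  have hm1 : AEStronglyMeasurable (ρ ⋆[ContinuousLinearMap.lsmul ℝ ℝ, volume] (W - g)) volume :=
    (hρs.continuous_convolution_left _ hρc
      (hWl.sub (hgc.locallyIntegrable (μ := volume)))).aestronglyMeasurable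
  have hm2 : AEStronglyMeasurable (fun x => (ρ ⋆[ContinuousLinearMap.lsmul ℝ ℝ, volume] g) x - g x)
      volume :=
    ((hρs.continuous_convolution_left _ hρc (hgc.locallyIntegrable (μ := volume))).sub hgc).aestronglyMeasurable
  have hm3 : AEStronglyMeasurable (W - g) volume := (hW.sub hgL).aestronglyMeasurable
  calc eLpNorm (fun x => (ρ ⋆[ContinuousLinearMap.lsmul ℝ ℝ, volume] W) x - W x) 2 volume
      = eLpNorm ((ρ ⋆[ContinuousLinearMap.lsmul ℝ ℝ, volume] (W - g)) +
        (fun x => (ρ ⋆[ContinuousLinearMap.lsmul ℝ ℝ, volume] g) x - g x) - (W - g)) 2 volume := by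
        congr 1
        funext x
        simp only [Pi.sub_apply, Pi.add_apply, hconv]
        abel
    _ ≤ eLpNorm (ρ ⋆[ContinuousLinearMap.lsmul ℝ ℝ, volume] (W - g)) 2 volume +
        eLpNorm (fun x => (ρ ⋆[ContinuousLinearMap.lsmul ℝ ℝ, volume] g) x - g x) 2 volume
        + eLpNorm (W - g) 2 volume :=
        (eLpNorm_sub_le (hm1.add hm2) hm3 (by norm_num)).trans
          (by gcongr; exact eLpNorm_add_le hm1 hm2 (by norm_num))
    _ ≤ δ + δ + δ := by
        gcongr
        exact hfirst.trans hgW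
    _ ≤ ε := by
        refine le_trans (le_of_eq ?_) hδ
        ring

lemma isTest_comp_sub_left {U : Set (Rn n)} (φ : ContDiffBump (0 : Rn n)) {x : Rn n}
    (hx : Metric.closedBall x φ.rOut ⊆ U) :
    IsTest U (fun y => φ.normed volume (x - y)) := by
  have hsub : tsupport (fun y => φ.normed volume (x - y)) ⊆ Metric.closedBall x φ.rOut := by
    refine closure_minimal (fun y hy => ?_) Metric.isClosed_closedBall
    have : x - y ∈ Function.support (φ.normed volume) := hy
    rw [φ.support_normed_eq] at this
    rw [Metric.mem_closedBall, dist_comm, dist_eq_norm]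
    simpa using (Metric.mem_ball.1 this).le
  refine ⟨φ.contDiff_normed.comp (contDiff_const.sub contDiff_id), ?_, hsub.trans hx⟩
  exact (isCompact_closedBall _ _).of_isClosed_subset (isClosed_tsupport _) hsub

/-- The derivative falls on the kernel, and `y ↦ ρ (x - y)` is an admissible test function in the
definition of the weak gradient because its support stays in `U`. -/
lemma gradient_mollify {U : Set (Rn n)} (hU : MeasurableSet U) {u : Rn n → ℝ} {Du : Rn n → Rn n}
    (hu : Continuous u) (hW : MemW12 U u Du) (φ : ContDiffBump (0 : Rn n)) {x : Rn n}
    (hx : Metric.closedBall x φ.rOut ⊆ U) :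
    gradient (φ.normed volume ⋆[ContinuousLinearMap.lsmul ℝ ℝ, volume] u) x =
      (φ.normed volume ⋆[ContinuousLinearMap.lsmul ℝ ℝ, volume] (U.indicator Du)) x := by
  set ρ := φ.normed volume with hρ
  have hρc : Continuous ρ := φ.continuous_normed
  have hρd : ContDiff ℝ ∞ ρ := φ.contDiff_normed
  have hρs : HasCompactSupport ρ := φ.hasCompactSupport_normed
  have hV : MemLp (U.indicator Du) 2 volume := (memLp_indicator_iff_restrict hU).2 hW.2.1
  have hVl : LocallyIntegrable (U.indicator Du) volume := hV.locallyIntegrable (by norm_num)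
  have hul : LocallyIntegrable u volume := hu.locallyIntegrable
  have htest := isTest_comp_sub_left φ hx
  refine ext_inner_right ℝ fun v => ?_
  have hρ1 : ContDiff ℝ 1 ρ := hρd.of_le (by exact_mod_cast le_top)
  have hd := hρs.hasFDerivAt_convolution_left (ContinuousLinearMap.lsmul ℝ ℝ) hρ1 hul x
  have hψ : ∀ y, fderiv ℝ (fun y => ρ (x - y)) y v = -fderiv ℝ ρ (x - y) v := fun y => by
    have h1 : HasFDerivAt (fun y : Rn n => x - y) (-ContinuousLinearMap.id ℝ (Rn n)) y :=
      (hasFDerivAt_id y).const_sub x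
    have h2 := ((hρ1.differentiable one_ne_zero).differentiableAt (x := x - y)).hasFDerivAt.comp y h1
    rw [show (fun y => ρ (x - y)) = ρ ∘ (fun y => x - y) from rfl, h2.fderiv]
    simp
  have hweak := hW.2.2 _ htest v
  have hsupp' : ∀ y, y ∉ U → fderiv ℝ (fun y => ρ (x - y)) y = 0 := fun y hy =>
    image_eq_zero_of_notMem_tsupport
      fun h => hy (htest.2.2 (tsupport_fderiv_subset ℝ h))
  have hint' := ((hρs.fderiv ℝ).convolutionExists_left
    ((ContinuousLinearMap.lsmul ℝ ℝ).precompL (Rn n)) (hρ1.continuous_fderiv one_ne_zero)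
    hul x).integrable_swap
  rw [inner_gradient_left, hd.fderiv, convolution_eq_swap, ContinuousLinearMap.integral_apply hint']
  simp only [ContinuousLinearMap.precompL_apply]
  have e1 : ∫ t, (ContinuousLinearMap.lsmul ℝ ℝ) (fderiv ℝ ρ (x - t) v) (u t) =
      -∫ y in U, u y * fderiv ℝ (fun y => ρ (x - y)) y v := by
    rw [setIntegral_eq_integral_of_forall_compl_eq_zero (fun y hy => by simp [hsupp' y hy]),
      ← integral_neg]
    refine integral_congr_ae (ae_of_all _ fun y => ?_)
    simp only [hψ, ContinuousLinearMap.lsmul_apply, smul_eq_mul]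
    ring
  rw [e1, hweak, neg_neg, convolution_eq_swap, real_inner_comm]
  have hint : Integrable (fun t => (ContinuousLinearMap.lsmul ℝ ℝ) (ρ (x - t)) (U.indicator Du t))
      volume := by
    have := hρs.convolutionExists_left (ContinuousLinearMap.lsmul ℝ ℝ) hρc hVl x
    exact this.integrable_swap
  rw [← integral_inner hint, ← integral_indicator hU]
  refine integral_congr_ae (ae_of_all _ fun y => ?_)
  by_cases hy : y ∈ U
  · simp [hy, inner_smul_right, real_inner_comm, hρ]
  · simp [hy]

/-- This replaces a chain rule for Sobolev functions: nonlinear expressions are formed with the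
smooth `w j`, and the limit uses uniform convergence of values and `L²` convergence of gradients on
`K`. -/
lemma exists_smooth_approx {U : Set (Rn n)} (hU : IsOpen U) {u : Rn n → ℝ} {Du : Rn n → Rn n}
    (hu : Continuous u) (hW : MemW12 U u Du) {K : Set (Rn n)} (hK : IsCompact K) (hKU : K ⊆ U) :
    ∃ w : ℕ → Rn n → ℝ, (∀ j, ContDiff ℝ ∞ (w j)) ∧
      (∀ ε > 0, ∀ᶠ j in atTop, ∀ x ∈ K, |w j x - u x| ≤ ε) ∧
      Tendsto (fun j => eLpNorm (fun x => gradient (w j) x - Du x) 2 (volume.restrict K))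
        atTop (𝓝 0) := by
  obtain ⟨d, hd, hdU⟩ := hK.exists_cthickening_subset_open hU hKU
  let φ : ℕ → ContDiffBump (0 : Rn n) := fun j =>
    ⟨1 / ((j : ℝ) + 1) / 2, 1 / ((j : ℝ) + 1), by positivity, half_lt_self (by positivity)⟩
  have hφ : Tendsto (fun j => (φ j).rOut) atTop (𝓝 0) := tendsto_one_div_add_atTop_nhds_zero_nat
  have hV : MemLp (U.indicator Du) 2 volume :=
    (memLp_indicator_iff_restrict hU.measurableSet).2 hW.2.1
  refine ⟨fun j => (φ j).normed volume ⋆[ContinuousLinearMap.lsmul ℝ ℝ, volume] u, fun j => ?_,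
    fun ε hε => ?_, ?_⟩
  · exact (φ j).hasCompactSupport_normed.contDiff_convolution_left _ (φ j).contDiff_normed
      hu.locallyIntegrable
  · have huc := (hK.cthickening (r := 1)).uniformContinuousOn_of_continuous hu.continuousOn
    rw [Metric.uniformContinuousOn_iff] at huc
    obtain ⟨r, hr, hur⟩ := huc ε hε
    filter_upwards [hφ.eventually_lt_const (lt_min hr one_pos)] with j hj x hx
    rw [← Real.dist_eq]
    refine (φ j).dist_normed_convolution_le hu.aestronglyMeasurable fun y hy => ?_
    have hyd := (Metric.mem_ball.1 hy).trans hj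
    refine (hur y ?_ x (Metric.self_subset_cthickening _ hx) (hyd.trans_le (min_le_left _ _))).le
    exact Metric.mem_cthickening_of_dist_le y x 1 _ hx (hyd.trans_le (min_le_right _ _)).le
  · refine tendsto_of_tendsto_of_tendsto_of_le_of_le' tendsto_const_nhds
      (tendsto_eLpNorm_mollify hφ hV) (Eventually.of_forall fun _ => zero_le) ?_
    filter_upwards [hφ.eventually_lt_const hd] with j hj
    refine le_trans (le_of_eq ?_) (eLpNorm_mono_measure _ (Measure.restrict_le_self (s := K)))
    refine eLpNorm_congr_ae ((ae_restrict_iff' hK.measurableSet).2 (ae_of_all _ fun x hx => ?_))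
    have : Metric.closedBall x (φ j).rOut ⊆ U := fun y hy => hdU
      (Metric.mem_cthickening_of_dist_le y x d _ hx ((Metric.mem_closedBall.1 hy).trans hj.le))
    simp only [gradient_mollify hU.measurableSet hu hW (φ j) this, indicator_of_mem (hKU hx)]

/-! ### Smooth truncations and cutoff functions -/

/-- A smooth substitute for `(s - k)₊`: the primitive of a smooth step rising from 0 to 1 on `[k, k
+ ε]`. Convexity gives `g s ≤ g' s * (s - k)`, which later lets the cross term be absorbed by a
gradient term weighted with `g'`. -/
lemma exists_smooth_truncation (k : ℝ) {ε : ℝ} (hε : 0 < ε) :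
    ∃ g : ℝ → ℝ, ContDiff ℝ ∞ g ∧ (∀ s, 0 ≤ g s) ∧ (∀ s, 0 ≤ deriv g s) ∧ (∀ s, deriv g s ≤ 1) ∧
      (∀ s ≤ k, g s = 0) ∧ (∀ s ≤ k, deriv g s = 0) ∧
      (∀ s, k ≤ s → g s ≤ deriv g s * (s - k)) ∧ ∀ s, s - k - ε ≤ g s := by
  let θ : ℝ → ℝ := fun τ => Real.smoothTransition ((τ - k) / ε)
  have hθ : ContDiff ℝ ∞ θ :=
    Real.smoothTransition.contDiff.comp ((contDiff_id.sub contDiff_const).div_const ε)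
  have hθc : Continuous θ := hθ.continuous
  have hθm : Monotone θ := fun a b hab => Real.smoothTransition.monotone (by gcongr)
  have hθ0 : ∀ s, 0 ≤ θ s := fun s => Real.smoothTransition.nonneg _
  have hθz : ∀ s ≤ k, θ s = 0 := fun s hs =>
    Real.smoothTransition.zero_of_nonpos (div_nonpos_of_nonpos_of_nonneg (by linarith) hε.le)
  have hθ1 : ∀ s, k + ε ≤ s → θ s = 1 := fun s hs =>
    Real.smoothTransition.one_of_one_le ((one_le_div hε).2 (by linarith))
  let g : ℝ → ℝ := fun s => ∫ τ in k..s, θ τ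
  have hd : ∀ s, HasDerivAt g (θ s) s := fun s => hθc.integral_hasStrictDerivAt k s |>.hasDerivAt
  have hdg : deriv g = θ := funext fun s => (hd s).deriv
  have hg0 : ∀ s ≤ k, g s = 0 := fun s hs => by
    refine (intervalIntegral.integral_congr (g := fun _ => 0) fun τ hτ => ?_).trans (by simp)
    rw [uIcc_of_ge hs] at hτ
    exact hθz τ hτ.2
  have hgn : ∀ s, 0 ≤ g s := fun s => by
    rcases le_total s k with hs | hs
    · exact (hg0 s hs).ge
    · exact intervalIntegral.integral_nonneg hs fun τ _ => hθ0 τ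
  refine ⟨g, ?_, hgn, ?_, ?_, hg0, ?_, ?_, ?_⟩
  · rw [contDiff_infty_iff_deriv]
    exact ⟨fun s => (hd s).differentiableAt, hdg ▸ hθ⟩
  · exact fun s => hdg ▸ hθ0 s
  · exact fun s => hdg ▸ Real.smoothTransition.le_one _
  · exact fun s hs => hdg ▸ hθz s hs
  · intro s hs
    rw [hdg]
    calc g s ≤ ∫ _ in k..s, θ s := intervalIntegral.integral_mono_on hs
          (hθc.intervalIntegrable _ _) intervalIntegrable_const fun τ hτ => hθm hτ.2
      _ = θ s * (s - k) := by simp [mul_comm]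
  · intro s
    rcases le_total s (k + ε) with hs | hs
    · linarith [hgn s]
    · have h1 : g s = (∫ τ in k..(k + ε), θ τ) + ∫ τ in (k + ε)..s, θ τ :=
        (intervalIntegral.integral_add_adjacent_intervals (hθc.intervalIntegrable _ _)
          (hθc.intervalIntegrable _ _)).symm
      have h2 : ∫ τ in (k + ε)..s, θ τ = s - (k + ε) := by
        rw [intervalIntegral.integral_congr (g := fun _ => 1) fun τ hτ => ?_]
        · simp
        · rw [uIcc_of_le hs] at hτ
          exact hθ1 τ hτ.1
      have h3 : 0 ≤ ∫ τ in k..(k + ε), θ τ := hgn (k + ε)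
      linarith

lemma exists_bound_deriv_smoothTransition :
    ∃ C : ℝ, 0 < C ∧ ∀ s, |deriv Real.smoothTransition s| ≤ C := by
  have hc : Continuous (deriv Real.smoothTransition) :=
    (Real.smoothTransition.contDiff (n := 1)).continuous_deriv le_rfl
  obtain ⟨C, hC⟩ := (isCompact_Icc (a := (0 : ℝ)) (b := 1)).exists_bound_of_continuousOn
    hc.continuousOn
  refine ⟨max C 1, by positivity, fun s => ?_⟩
  by_cases hs : s ∈ Icc (0 : ℝ) 1
  · exact (hC s hs).trans (le_max_left _ _)
  · suffices deriv Real.smoothTransition s = 0 by rw [this, abs_zero]; positivity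
    rw [mem_Icc, not_and_or, not_le, not_le] at hs
    rcases hs with hs | hs
    · refine IsLocalMin.deriv_eq_zero (Eventually.of_forall fun t => ?_)
      rw [Real.smoothTransition.zero_of_nonpos hs.le]
      exact Real.smoothTransition.nonneg t
    · refine IsLocalMax.deriv_eq_zero (Eventually.of_forall fun t => ?_)
      rw [Real.smoothTransition.one_of_one_le hs.le]
      exact Real.smoothTransition.le_one t

lemma norm_gradient (w : Rn n → ℝ) (x : Rn n) : ‖gradient w x‖ = ‖fderiv ℝ w x‖ := by
  simp [gradient]

/-- The cutoff is a smooth step in `‖y - x‖ ^ 2`, which keeps it smooth at the centre. The gradient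
bound comes from `2r / (r² - ρ²) ≤ 2 / (r - ρ)`, so its constant does not depend on the dimension.
-/
lemma exists_cutoff : ∃ C : ℝ, 0 < C ∧ ∀ (n : ℕ) (x : Rn n) (ρ r : ℝ), 0 < ρ → ρ < r →
    ∃ η : Rn n → ℝ, ContDiff ℝ ∞ η ∧ (∀ y, 0 ≤ η y) ∧ (∀ y, η y ≤ 1) ∧
      (∀ y ∈ Metric.ball x ρ, η y = 1) ∧ (∀ y, y ∉ Metric.ball x r → η y = 0) ∧
      ∀ y, ‖gradient η y‖ ≤ C / (r - ρ) := by
  obtain ⟨C, hC0, hC⟩ := exists_bound_deriv_smoothTransition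
  refine ⟨2 * C, by positivity, fun n x ρ r hρ hr => ?_⟩
  have hD : 0 < r ^ 2 - ρ ^ 2 := by nlinarith
  let q : Rn n → ℝ := fun y => (r ^ 2 - ‖y - x‖ ^ 2) / (r ^ 2 - ρ ^ 2)
  have hq : ContDiff ℝ ∞ q :=
    (contDiff_const.sub ((contDiff_id.sub contDiff_const).norm_sq ℝ)).div_const _
  have hqn : ∀ y, y ∉ Metric.ball x r → q y ≤ 0 := fun y hy => by
    rw [Metric.mem_ball, not_lt, dist_eq_norm] at hy
    refine div_nonpos_of_nonpos_of_nonneg ?_ hD.le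
    nlinarith
  refine ⟨fun y => Real.smoothTransition (q y), Real.smoothTransition.contDiff.comp hq,
    fun y => Real.smoothTransition.nonneg _, fun y => Real.smoothTransition.le_one _,
    fun y hy => Real.smoothTransition.one_of_one_le ?_,
    fun y hy => Real.smoothTransition.zero_of_nonpos (hqn y hy), fun y => ?_⟩
  · rw [Metric.mem_ball, dist_eq_norm] at hy
    rw [one_le_div hD]
    nlinarith [norm_nonneg (y - x)]
  · rw [norm_gradient]
    have h1 : HasFDerivAt q ((-(2 * (r ^ 2 - ρ ^ 2)⁻¹)) • (innerSL ℝ (y - x) : Rn n →L[ℝ] ℝ)) y := by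
      have h := ((hasFDerivAt_id (𝕜 := ℝ) y).sub_const x).norm_sq
      have h' := (h.const_sub (r ^ 2)).const_mul (r ^ 2 - ρ ^ 2)⁻¹
      refine (h'.congr_fderiv ?_).congr_of_eventuallyEq (Eventually.of_forall fun z => ?_)
      · ext v; simp; ring
      · simp [q, div_eq_inv_mul]
    have h2 := ((Real.smoothTransition.contDiff (n := 1)).differentiable one_ne_zero
      (q y)).hasDerivAt.comp_hasFDerivAt y h1
    have h3 : fderiv ℝ (fun y => Real.smoothTransition (q y)) y = _ := h2.fderiv
    rw [h3, norm_smul, Real.norm_eq_abs]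
    by_cases hy : y ∈ Metric.ball x r
    · rw [Metric.mem_ball, dist_eq_norm] at hy
      have h4 : ‖(-(2 * (r ^ 2 - ρ ^ 2)⁻¹)) • (innerSL ℝ (y - x) : Rn n →L[ℝ] ℝ)‖
          ≤ 2 / (r - ρ) := by
        rw [norm_smul, norm_neg, innerSL_apply_norm, Real.norm_of_nonneg (by positivity),
          mul_comm 2, mul_assoc]
        rw [inv_mul_le_iff₀ hD, mul_div_assoc', le_div_iff₀ (by linarith)]
        nlinarith [norm_nonneg (y - x), mul_pos (sub_pos.2 hr) hρ]
      calc _ ≤ C * (2 / (r - ρ)) := mul_le_mul (hC _) h4 (norm_nonneg _) hC0.le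
        _ = _ := by ring
    · have h5 : deriv Real.smoothTransition (q y) = 0 := by
        refine IsLocalMin.deriv_eq_zero (Eventually.of_forall fun t => ?_)
        rw [Real.smoothTransition.zero_of_nonpos (hqn y hy)]
        exact Real.smoothTransition.nonneg t
      rw [h5, abs_zero, zero_mul]
      exact div_nonneg (by positivity) (by linarith)

/-! ### Elliptic matrices -/

section Matrix

variable {M : Matrix (Fin n) (Fin n) ℝ} {lam Lam : ℝ}

lemma inner_toEuclideanLin_comm (hM : M.IsSymm) (ξ ζ : Rn n) :
    inner ℝ (Matrix.toEuclideanLin M ξ) ζ = inner ℝ (Matrix.toEuclideanLin M ζ) ξ := by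
  have : (Matrix.toEuclideanLin M).IsSymmetric := by
    rw [Matrix.isSymmetric_toEuclideanLin_iff]
    rwa [Matrix.IsHermitian, Matrix.conjTranspose_eq_transpose_of_trivial]
  rw [this ξ ζ, real_inner_comm]

lemma neg_two_mul_inner_le (hM : M.IsSymm)
    (hpos : ∀ ξ : Rn n, 0 ≤ inner ℝ (Matrix.toEuclideanLin M ξ) ξ) (a b : ℝ) (ξ ζ : Rn n) :
    -(2 * (a * b) * inner ℝ (Matrix.toEuclideanLin M ξ) ζ) ≤
      a ^ 2 * inner ℝ (Matrix.toEuclideanLin M ξ) ξ +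
      b ^ 2 * inner ℝ (Matrix.toEuclideanLin M ζ) ζ := by
  have h := hpos (a • ξ + b • ζ)
  simp only [map_add, map_smul, inner_add_left, inner_add_right, inner_smul_left, inner_smul_right,
    RCLike.conj_to_real, inner_toEuclideanLin_comm hM ζ ξ] at h
  nlinarith

lemma norm_toEuclideanLin_le (hM : M.IsSymm) (hLam : 0 < Lam)
    (hpos : ∀ ξ : Rn n, 0 ≤ inner ℝ (Matrix.toEuclideanLin M ξ) ξ)
    (hle : ∀ ξ : Rn n, inner ℝ (Matrix.toEuclideanLin M ξ) ξ ≤ Lam * ‖ξ‖ ^ 2) (ξ : Rn n) :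
    ‖Matrix.toEuclideanLin M ξ‖ ≤ Lam * ‖ξ‖ := by
  set ζ := Matrix.toEuclideanLin M ξ with hζ
  -- With `ζ = Mξ` this reads `2Λ‖ζ‖² ≤ Λ²⟨Mξ, ξ⟩ + ⟨Mζ, ζ⟩`. The upper form bound leaves `Λ‖ζ‖² ≤
  -- Λ³‖ξ‖²`.
  have h := neg_two_mul_inner_le hM hpos Lam (-1) ξ ζ
  rw [← hζ, real_inner_self_eq_norm_sq] at h
  have h1 := mul_le_mul_of_nonneg_left (hle ξ) (sq_nonneg Lam)
  have h2 := hle ζ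
  have h3 : Lam * ‖ζ‖ ^ 2 ≤ Lam * (Lam * ‖ξ‖) ^ 2 := by nlinarith
  exact le_of_sq_le_sq (le_of_mul_le_mul_left h3 hLam) (by positivity)

end Matrix

lemma aestronglyMeasurable_toEuclideanLin {A : Rn n → Matrix (Fin n) (Fin n) ℝ}
    (hA : ∀ i j, Measurable fun x => A x i j) {μ : Measure (Rn n)} {V : Rn n → Rn n}
    (hV : AEStronglyMeasurable V μ) :
    AEStronglyMeasurable (fun x => Matrix.toEuclideanLin (A x) (V x)) μ := by
  have h : AEMeasurable (fun x => (Matrix.toEuclideanLin (A x) (V x)).ofLp) μ := by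
    rw [aemeasurable_pi_iff]
    intro i
    have : (fun x => (Matrix.toEuclideanLin (A x) (V x)).ofLp i) =
        fun x => ∑ j, A x i j * (V x).ofLp j := by
      funext x
      simp [Matrix.toLpLin_apply, Matrix.mulVec, dotProduct]
    rw [this]
    refine Finset.aemeasurable_fun_sum _ fun j _ => (hA i j).aemeasurable.mul ?_
    exact (EuclideanSpace.proj (𝕜 := ℝ) j).continuous.measurable.comp_aemeasurable hV.aemeasurable
  exact ((PiLp.continuous_toLp 2 _).measurable.comp_aemeasurable h).aestronglyMeasurable

lemma memLp_toEuclideanLin {A : Rn n → Matrix (Fin n) (Fin n) ℝ} {lam Lam : ℝ}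
    (hlam : 0 < lam) (hLam : lam ≤ Lam) (hA : IsUniformlyElliptic A lam Lam) {U : Set (Rn n)}
    {V : Rn n → Rn n} (hV : MemLp V 2 (volume.restrict U)) :
    MemLp (fun x => Matrix.toEuclideanLin (A x) (V x)) 2 (volume.restrict U) := by
  refine hV.of_le_mul (c := Lam)
    (aestronglyMeasurable_toEuclideanLin hA.1 hV.aestronglyMeasurable) ?_
  filter_upwards [ae_restrict_of_ae hA.2] with x hx
  exact norm_toEuclideanLin_le hx.1 (hlam.trans_le hLam)
    (fun ξ => (by positivity : 0 ≤ lam * ‖ξ‖ ^ 2).trans (hx.2 ξ).1) (fun ξ => (hx.2 ξ).2) _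

/-! ### Test functions and their gradients -/

lemma continuous_gradient {ψ : Rn n → ℝ} (hψ : ContDiff ℝ ∞ ψ) : Continuous (gradient ψ) :=
  (InnerProductSpace.toDual ℝ (Rn n)).symm.continuous.comp
    (hψ.continuous_fderiv (by simp))

lemma gradient_eq_zero_of_notMem_tsupport {ψ : Rn n → ℝ} {x : Rn n} (hx : x ∉ tsupport ψ) :
    gradient ψ x = 0 := by
  rw [← norm_eq_zero, norm_gradient, norm_eq_zero]
  exact image_eq_zero_of_notMem_tsupport fun h => hx (tsupport_fderiv_subset ℝ h)

lemma IsTest.memLp_gradient {U : Set (Rn n)} {ψ : Rn n → ℝ} (hψ : IsTest U ψ) {p : ℝ≥0∞} :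
    MemLp (gradient ψ) p volume :=
  (continuous_gradient hψ.1).memLp_of_hasCompactSupport
    (HasCompactSupport.intro hψ.2.1 fun _ hx => gradient_eq_zero_of_notMem_tsupport hx)

lemma IsTest.memW120 {U : Set (Rn n)} {ψ : Rn n → ℝ} (hψ : IsTest U ψ) :
    MemW120 U ψ (gradient ψ) := by
  refine ⟨⟨(hψ.1.continuous.memLp_of_hasCompactSupport hψ.2.1).restrict _,
    hψ.memLp_gradient.restrict _, fun χ hχ v => ?_⟩, fun _ => ψ, fun _ => hψ, by simp, by simp⟩
  have hd : ∀ {w : Rn n → ℝ}, IsTest U w → Continuous fun x => fderiv ℝ w x v := fun hw =>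
    (hw.1.continuous_fderiv (by simp)).clm_apply continuous_const
  rw [setIntegral_eq_integral_of_forall_compl_eq_zero, setIntegral_eq_integral_of_forall_compl_eq_zero,
    integral_mul_fderiv_eq_neg_fderiv_mul_of_integrable]
  · simp [mul_comm]
  · exact ((hd hψ).mul hχ.1.continuous).integrable_of_hasCompactSupport hχ.2.1.mul_left
  · exact (hψ.1.continuous.mul (hd hχ)).integrable_of_hasCompactSupport hψ.2.1.mul_right
  · exact (hψ.1.continuous.mul hχ.1.continuous).integrable_of_hasCompactSupport hψ.2.1.mul_right
  · exact fun x _ => hψ.1.differentiable (by simp) x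
  · exact fun x _ => hχ.1.differentiable (by simp) x
  · intro x hx
    rw [image_eq_zero_of_notMem_tsupport fun h => hx (hχ.2.2 h), zero_mul]
  · intro x hx
    rw [image_eq_zero_of_notMem_tsupport fun h => hx (hψ.2.2 h), zero_mul]

lemma gradient_mul_comp {η w : Rn n → ℝ} {g : ℝ → ℝ} (hη : ContDiff ℝ ∞ η) (hw : ContDiff ℝ ∞ w)
    (hg : ContDiff ℝ ∞ g) (x : Rn n) :
    gradient (fun y => η y * g (w y)) x =
      g (w x) • gradient η x + (η x * deriv g (w x)) • gradient w x := by
  have h1 : HasFDerivAt η (InnerProductSpace.toDual ℝ (Rn n) (gradient η x)) x :=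
    (hη.differentiable (by simp) x).hasGradientAt
  have h2 : HasFDerivAt w (InnerProductSpace.toDual ℝ (Rn n) (gradient w x)) x :=
    (hw.differentiable (by simp) x).hasGradientAt
  have h3 := h1.mul ((hg.differentiable (by simp) (w x)).hasDerivAt.comp_hasFDerivAt x h2)
  refine HasGradientAt.gradient (HasFDerivAt.congr_fderiv h3 ?_)
  simp only [map_add, map_smul, Function.comp_apply, smul_smul]
  exact add_comm _ _

lemma gradient_sq_mul_comp {η w : Rn n → ℝ} {g : ℝ → ℝ} (hη : ContDiff ℝ ∞ η)
    (hw : ContDiff ℝ ∞ w) (hg : ContDiff ℝ ∞ g) (x : Rn n) :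
    gradient (fun y => η y * (η y * g (w y))) x =
      (2 * η x * g (w x)) • gradient η x + (η x ^ 2 * deriv g (w x)) • gradient w x := by
  have h1 : HasFDerivAt η (InnerProductSpace.toDual ℝ (Rn n) (gradient η x)) x :=
    (hη.differentiable (by simp) x).hasGradientAt
  have h2 : HasFDerivAt w (InnerProductSpace.toDual ℝ (Rn n) (gradient w x)) x :=
    (hw.differentiable (by simp) x).hasGradientAt
  have h3 := h1.mul
    (h1.mul ((hg.differentiable (by simp) (w x)).hasDerivAt.comp_hasFDerivAt x h2))
  refine HasGradientAt.gradient (HasFDerivAt.congr_fderiv h3 ?_)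
  simp only [map_add, map_smul, Function.comp_apply, Pi.mul_apply]
  module

/-! ### Energy estimates -/

lemma tendsto_integral_norm_mul_of_eLpNorm {α E F : Type*} [MeasurableSpace α] {μ : Measure α}
    [NormedAddCommGroup E] [NormedAddCommGroup F] {B : α → E} (hB : MemLp B 2 μ)
    {D : ℕ → α → F} (hDm : ∀ j, AEStronglyMeasurable (D j) μ)
    (hD : Tendsto (fun j => eLpNorm (D j) 2 μ) atTop (𝓝 0)) :
    Tendsto (fun j => ∫⁻ x, ‖B x‖ₑ * ‖D j x‖ₑ ∂μ) atTop (𝓝 0) := by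
  have h : Tendsto (fun j => eLpNorm B 2 μ * eLpNorm (D j) 2 μ) atTop (𝓝 0) := by
    simpa using ENNReal.Tendsto.const_mul hD (Or.inr hB.eLpNorm_ne_top)
  refine tendsto_of_tendsto_of_tendsto_of_le_of_le tendsto_const_nhds h (fun _ => zero_le)
    fun j => ?_
  have := ENNReal.lintegral_mul_le_Lp_mul_Lq μ (p := 2) (q := 2) (by constructor <;> norm_num)
    hB.aestronglyMeasurable.enorm (hDm j).enorm
  have e : ∀ {G : Type _} [NormedAddCommGroup G] (W : α → G),
      eLpNorm W 2 μ = (∫⁻ x, ‖W x‖ₑ ^ (2 : ℝ) ∂μ) ^ (1 / 2 : ℝ) := fun W => by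
    rw [eLpNorm_eq_lintegral_rpow_enorm_toReal two_ne_zero ENNReal.ofNat_ne_top]; simp
  rw [e B, eLpNorm_eq_lintegral_rpow_enorm_toReal two_ne_zero ENNReal.ofNat_ne_top]
  simpa using this

/-- Testing the inequality with `η² g(u)`. -/
lemma energy_inequality {A : Rn n → Matrix (Fin n) (Fin n) ℝ} {lam Lam : ℝ}
    (hlam : 0 < lam) (hLam : lam ≤ Lam) (hA : IsUniformlyElliptic A lam Lam)
    {f : ℝ → ℝ} (hf0 : ∀ t, 0 ≤ f t) (hf : Monotone f) {U : Set (Rn n)} (hU : IsOpen U)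
    {u : Rn n → ℝ} (hu : Continuous u) {Du : Rn n → Rn n} (hW : MemW12 U u Du)
    (hsub : ∀ (φ : Rn n → ℝ) (Dφ : Rn n → Rn n), MemW120 U φ Dφ →
      (∀ᵐ x ∂(volume.restrict U), 0 ≤ φ x) →
      IntegrableOn (fun x => f (u x) * φ x) U ∧
      ∫ x in U, inner ℝ (Matrix.toEuclideanLin (A x) (Du x)) (Dφ x) ≤
        -∫ x in U, f (u x) * φ x)
    {η : Rn n → ℝ} (hη : IsTest U η) (hη1 : ∀ x, |η x| ≤ 1)
    {g : ℝ → ℝ} (hg : ContDiff ℝ ∞ g) (hg0 : ∀ s, 0 ≤ g s) (hg' : ∀ s, |deriv g s| ≤ 1) :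
    IntegrableOn (fun x => 2 * η x * g (u x) *
        inner ℝ (Matrix.toEuclideanLin (A x) (Du x)) (gradient η x) +
      η x ^ 2 * deriv g (u x) * inner ℝ (Matrix.toEuclideanLin (A x) (Du x)) (Du x) +
      f (u x) * (η x ^ 2 * g (u x))) U ∧
    ∫ x in U, (2 * η x * g (u x) *
        inner ℝ (Matrix.toEuclideanLin (A x) (Du x)) (gradient η x) +
      η x ^ 2 * deriv g (u x) * inner ℝ (Matrix.toEuclideanLin (A x) (Du x)) (Du x) +
      f (u x) * (η x ^ 2 * g (u x))) ≤ 0 := by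
  set B : Rn n → Rn n := fun x => Matrix.toEuclideanLin (A x) (Du x) with hBdef
  set μ := volume.restrict U with hμ
  set K := tsupport η with hK
  have hKc : IsCompact K := hη.2.1
  have hB : MemLp B 2 μ := memLp_toEuclideanLin hlam hLam hA hW.2.1
  have hDη : MemLp (gradient η) 2 μ := hη.memLp_gradient.restrict _
  obtain ⟨w, hwd, hwu, hwD⟩ := exists_smooth_approx hU hu hW hKc hη.2.2
  have hηK : ∀ x, x ∉ K → η x = 0 := fun x hx => image_eq_zero_of_notMem_tsupport hx
  obtain ⟨m, hm⟩ := hKc.exists_bound_of_continuousOn hu.continuousOn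
  obtain ⟨G, hG⟩ := (isCompact_Icc (a := -(m + 1)) (b := m + 1)).exists_bound_of_continuousOn
    hg.continuous.continuousOn
  have hgc : Continuous g := hg.continuous
  have hg'c : Continuous (deriv g) := hg.continuous_deriv (by simp)
  have hηc : Continuous η := hη.1.continuous
  -- For the test function `η² g(w j)`, the tested integrand equals `P (w j) + Q j`. Here `P`
  -- already contains `Du`, and `Q j` carries the error `gradient (w j) - Du`, which vanishes in the
  -- limit.
  let P : (Rn n → ℝ) → Rn n → ℝ := fun v x => 2 * η x * g (v x) * inner ℝ (B x) (gradient η x) +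
    η x ^ 2 * deriv g (v x) * inner ℝ (B x) (Du x) + f (u x) * (η x ^ 2 * g (v x))
  let Q : ℕ → Rn n → ℝ := fun j x => η x ^ 2 * deriv g (w j x) *
    inner ℝ (B x) (gradient (w j) x - Du x)
  have hfm : Measurable fun x => f (u x) := hf.measurable.comp hu.measurable
  have hPm : ∀ v, Continuous v → AEStronglyMeasurable (P v) μ := fun v hv => by
    have i1 := hB.aestronglyMeasurable.inner (𝕜 := ℝ) hDη.aestronglyMeasurable
    have i2 := hB.aestronglyMeasurable.inner (𝕜 := ℝ) hW.2.1.aestronglyMeasurable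
    have c1 : Continuous fun x => 2 * η x * g (v x) := by fun_prop
    have c2 : Continuous fun x => η x ^ 2 * deriv g (v x) := by fun_prop
    have c3 : Continuous fun x => η x ^ 2 * g (v x) := by fun_prop
    exact ((c1.aestronglyMeasurable.mul i1).add (c2.aestronglyMeasurable.mul i2)).add
      (hfm.aestronglyMeasurable.mul c3.aestronglyMeasurable)
  let bound : Rn n → ℝ := fun x => 2 * G * (‖B x‖ * ‖gradient η x‖) + ‖B x‖ * ‖Du x‖ +
    f m * G * |η x|
  have hbound : Integrable bound μ := by
    refine (((hB.norm.integrable_mul hDη.norm).const_mul (2 * G)).add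
      (hB.norm.integrable_mul hW.2.1.norm)).add (Integrable.const_mul ?_ _)
    exact ((hηc.integrable_of_hasCompactSupport hη.2.1).abs).restrict
  have hPle : ∀ v : Rn n → ℝ, (∀ x ∈ K, |v x - u x| ≤ 1) → ∀ x, ‖P v x‖ ≤ bound x := by
    intro v hv x
    by_cases hx : x ∈ K
    · have hux := hm x hx
      have hvx : v x ∈ Icc (-(m + 1)) (m + 1) := by
        have h1 := abs_le.1 (hv x hx)
        have h2 := abs_le.1 hux
        constructor <;> linarith
      have hgv := hG _ hvx
      rw [Real.norm_eq_abs] at hgv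
      have hG0 : 0 ≤ G := (abs_nonneg _).trans hgv
      have hfu : |f (u x)| ≤ f m := by
        rw [abs_of_nonneg (hf0 _)]; exact hf ((le_abs_self _).trans hux)
      have hfm0 := hf0 m
      have hη2 : η x ^ 2 ≤ |η x| := by
        rw [← sq_abs, sq]; exact mul_le_of_le_one_left (abs_nonneg _) (hη1 x)
      refine (norm_add_le _ _).trans (add_le_add ((norm_add_le _ _).trans (add_le_add ?_ ?_)) ?_)
      · simp only [norm_mul, Real.norm_eq_abs, abs_two]
        calc 2 * |η x| * |g (v x)| * |inner ℝ (B x) (gradient η x)|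
            ≤ 2 * 1 * G * (‖B x‖ * ‖gradient η x‖) := by
              gcongr
              · exact hη1 x
              · exact abs_real_inner_le_norm _ _
          _ = _ := by ring
      · simp only [norm_mul, Real.norm_eq_abs, norm_pow, sq_abs]
        calc η x ^ 2 * |deriv g (v x)| * |inner ℝ (B x) (Du x)|
            ≤ 1 * 1 * (‖B x‖ * ‖Du x‖) := by
              gcongr
              · exact hη2.trans (hη1 x)
              · exact hg' _
              · exact abs_real_inner_le_norm _ _
          _ = _ := by ring
      · simp only [norm_mul, Real.norm_eq_abs, norm_pow, sq_abs]
        calc |f (u x)| * (η x ^ 2 * |g (v x)|) ≤ f m * (|η x| * G) := by gcongr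
          _ = _ := by ring
    · have : P v x = 0 := by simp [P, hηK x hx]
      rw [this, norm_zero]
      simp only [bound, hηK x hx, abs_zero, mul_zero, add_zero,
        gradient_eq_zero_of_notMem_tsupport hx, norm_zero, zero_add]
      positivity
  have hPint : Integrable (P u) μ := hbound.mono' (hPm u hu)
    (ae_of_all _ (hPle u fun x _ => by simp))
  have hev := hwu 1 one_pos
  have hPint' : ∀ᶠ j in atTop, Integrable (P (w j)) μ := hev.mono fun j hj =>
    hbound.mono' (hPm _ (hwd j).continuous) (ae_of_all _ (hPle _ hj))
  have hPlim : Tendsto (fun j => ∫ x, P (w j) x ∂μ) atTop (𝓝 (∫ x, P u x ∂μ)) := by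
    refine tendsto_integral_filter_of_dominated_convergence bound
      (Eventually.of_forall fun j => hPm _ (hwd j).continuous)
      (hev.mono fun j hj => ae_of_all _ (hPle _ hj)) hbound (ae_of_all _ fun x => ?_)
    by_cases hx : x ∈ K
    · have hwx : Tendsto (fun j => w j x) atTop (𝓝 (u x)) := by
        rw [Metric.tendsto_nhds]
        intro ε hε
        filter_upwards [hwu (ε / 2) (half_pos hε)] with j hj
        rw [Real.dist_eq]
        linarith [hj x hx]
      have t1 := (hgc.tendsto _).comp hwx
      have t2 := (hg'c.tendsto _).comp hwx
      exact (((t1.const_mul _).mul_const _).add ((t2.const_mul _).mul_const _)).add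
        ((t1.const_mul _).const_mul _)
    · simp [P, hηK x hx]
  have hDm : ∀ j, AEStronglyMeasurable (fun x => gradient (w j) x - Du x) (volume.restrict K) :=
    fun j => (continuous_gradient (hwd j)).aestronglyMeasurable.sub
      (hW.2.1.aestronglyMeasurable.mono_measure (Measure.restrict_mono_set _ hη.2.2))
  have hL := tendsto_integral_norm_mul_of_eLpNorm
    (hB.mono_measure (Measure.restrict_mono_set _ hη.2.2)) hDm hwD
  have hQle : ∀ j, ∫⁻ x, ‖Q j x‖ₑ ∂μ ≤
      ∫⁻ x in K, ‖B x‖ₑ * ‖gradient (w j) x - Du x‖ₑ := fun j => by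
    have hKU : K ∩ U = K := inter_eq_self_of_subset_left hη.2.2
    calc ∫⁻ x, ‖Q j x‖ₑ ∂μ
        ≤ ∫⁻ x, K.indicator (fun x => ‖B x‖ₑ * ‖gradient (w j) x - Du x‖ₑ) x ∂μ := by
          refine lintegral_mono fun x => ?_
          by_cases hx : x ∈ K
          · rw [indicator_of_mem hx, ← enorm_norm (B x), ← enorm_norm (gradient (w j) x - Du x),
              ← enorm_mul]
            refine enorm_le_iff_norm_le.2 ?_
            simp only [Q, norm_mul, norm_pow, Real.norm_eq_abs]
            have h1 : |η x| ^ 2 ≤ 1 := pow_le_one₀ (abs_nonneg _) (hη1 x)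
            calc |η x| ^ 2 * |deriv g (w j x)| * |inner ℝ (B x) (gradient (w j) x - Du x)|
                ≤ 1 * 1 * (‖B x‖ * ‖gradient (w j) x - Du x‖) := by
                  gcongr
                  · exact hg' _
                  · exact abs_real_inner_le_norm _ _
              _ = _ := by rw [abs_norm, abs_norm]; ring
          · simp [Q, hηK x hx]
      _ = ∫⁻ x in K, ‖B x‖ₑ * ‖gradient (w j) x - Du x‖ₑ := by
          rw [hμ, setLIntegral_indicator hKc.measurableSet, hKU]
  have hQlim : Tendsto (fun j => ∫ x, Q j x ∂μ) atTop (𝓝 0) := by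
    rw [tendsto_zero_iff_enorm_tendsto_zero]
    exact tendsto_of_tendsto_of_tendsto_of_le_of_le tendsto_const_nhds hL (fun _ => zero_le)
      fun j => (enorm_integral_le_lintegral_enorm _).trans (hQle j)
  have hQint : ∀ᶠ j in atTop, Integrable (Q j) μ := by
    filter_upwards [hL.eventually_lt_const ENNReal.zero_lt_top] with j hj
    refine ⟨?_, (hQle j).trans_lt hj⟩
    have c1 : Continuous fun x => η x ^ 2 * deriv g (w j x) :=
      (hηc.pow 2).mul (hg'c.comp (hwd j).continuous)
    exact c1.aestronglyMeasurable.mul (hB.aestronglyMeasurable.inner (𝕜 := ℝ)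
      ((continuous_gradient (hwd j)).aestronglyMeasurable.sub hW.2.1.aestronglyMeasurable))
  refine ⟨hPint, ?_⟩
  have hlim := hPlim.add hQlim
  rw [add_zero] at hlim
  refine le_of_tendsto hlim ?_
  filter_upwards [hPint', hQint] with j hP hQ
  let φ : Rn n → ℝ := fun y => η y * (η y * g (w j y))
  have hφ : IsTest U φ := by
    refine ⟨hη.1.mul (hη.1.mul (hg.comp (hwd j))), hη.2.1.mul_right, ?_⟩
    exact (tsupport_mul_subset_left).trans hη.2.2
  obtain ⟨hi, hle⟩ := hsub φ _ hφ.memW120 (ae_of_all _ fun x => by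
    simp only [φ, ← mul_assoc]
    exact mul_nonneg (mul_self_nonneg _) (hg0 _))
  have hBi : Integrable (fun x => inner ℝ (B x) (gradient φ x)) μ := by
    refine (hB.norm.integrable_mul ((hφ.memLp_gradient (p := 2)).restrict U).norm).mono'
      (hB.aestronglyMeasurable.inner (𝕜 := ℝ)
        (continuous_gradient hφ.1).aestronglyMeasurable) (ae_of_all _ fun x => ?_)
    exact abs_real_inner_le_norm _ _
  rw [← integral_add hP hQ]
  have : ∫ x, P (w j) x + Q j x ∂μ =
      ∫ x, inner ℝ (B x) (gradient φ x) ∂μ + ∫ x, f (u x) * φ x ∂μ := by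
    rw [← integral_add hBi hi]
    refine integral_congr_ae (ae_of_all _ fun x => ?_)
    simp only [P, Q, φ, gradient_sq_mul_comp hη.1 (hwd j) hg, inner_add_right, inner_smul_right,
      inner_sub_right]
    ring
  rw [this]
  linarith

/-- Caccioppoli's inequality, with the contribution of the right-hand side, for the smooth
truncation `g` of `u - k`. -/
lemma caccioppoli {A : Rn n → Matrix (Fin n) (Fin n) ℝ} {lam Lam : ℝ}
    (hlam : 0 < lam) (hLam : lam ≤ Lam) (hA : IsUniformlyElliptic A lam Lam)
    {f : ℝ → ℝ} (hf0 : ∀ t, 0 ≤ f t) (hf : Monotone f) {U : Set (Rn n)} (hU : IsOpen U)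
    {u : Rn n → ℝ} (hu : Continuous u) {Du : Rn n → Rn n} (hW : MemW12 U u Du)
    (hsub : ∀ (φ : Rn n → ℝ) (Dφ : Rn n → Rn n), MemW120 U φ Dφ →
      (∀ᵐ x ∂(volume.restrict U), 0 ≤ φ x) →
      IntegrableOn (fun x => f (u x) * φ x) U ∧
      ∫ x in U, inner ℝ (Matrix.toEuclideanLin (A x) (Du x)) (Dφ x) ≤
        -∫ x in U, f (u x) * φ x)
    {η : Rn n → ℝ} (hη : IsTest U η) (hη0 : ∀ x, 0 ≤ η x) (hη1 : ∀ x, η x ≤ 1)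
    {x₀ : Rn n} {r L : ℝ} (hball : Metric.ball x₀ r ⊆ U) (hηr : ∀ y ∉ Metric.ball x₀ r, η y = 0)
    (hηL : ∀ y, ‖gradient η y‖ ≤ L)
    {g : ℝ → ℝ} {k H : ℝ} (hg : ContDiff ℝ ∞ g) (hg0 : ∀ s, 0 ≤ g s) (hg'0 : ∀ s, 0 ≤ deriv g s)
    (hg'1 : ∀ s, deriv g s ≤ 1) (hgk : ∀ s ≤ k, g s = 0) (hg'k : ∀ s ≤ k, deriv g s = 0)
    (hgg : ∀ s, k ≤ s → g s ≤ deriv g s * (s - k))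
    (hH : ∀ y ∈ Metric.ball x₀ r, u y ≤ k + H) :
    IntegrableOn (fun x => lam / 2 * (η x ^ 2 * deriv g (u x) * ‖Du x‖ ^ 2) +
      f (u x) * (η x ^ 2 * g (u x))) (Metric.ball x₀ r ∩ {y | k < u y}) ∧
    ∫ x in Metric.ball x₀ r ∩ {y | k < u y},
      (lam / 2 * (η x ^ 2 * deriv g (u x) * ‖Du x‖ ^ 2) + f (u x) * (η x ^ 2 * g (u x))) ≤
      2 * Lam * H ^ 2 * L ^ 2 * (volume (Metric.ball x₀ r ∩ {y | k < u y})).toReal := by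
  set S := Metric.ball x₀ r ∩ {y | k < u y} with hS
  have hSm : MeasurableSet S :=
    (Metric.isOpen_ball.inter (isOpen_lt continuous_const hu)).measurableSet
  have hSU : S ⊆ U := inter_subset_left.trans hball
  have hSfin : volume S ≠ ⊤ :=
    ((measure_mono inter_subset_left).trans_lt Metric.isBounded_ball.measure_lt_top).ne
  obtain ⟨hTi, hT⟩ := energy_inequality hlam hLam hA hf0 hf hU hu hW hsub hη
    (fun x => abs_le.2 ⟨by linarith [hη0 x], hη1 x⟩) hg hg0
    (fun s => abs_le.2 ⟨by linarith [hg'0 s], hg'1 s⟩)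
  set T : Rn n → ℝ := fun x => 2 * η x * g (u x) *
        inner ℝ (Matrix.toEuclideanLin (A x) (Du x)) (gradient η x) +
      η x ^ 2 * deriv g (u x) * inner ℝ (Matrix.toEuclideanLin (A x) (Du x)) (Du x) +
      f (u x) * (η x ^ 2 * g (u x)) with hTdef
  set J : Rn n → ℝ := fun x => lam / 2 * (η x ^ 2 * deriv g (u x) * ‖Du x‖ ^ 2) +
      f (u x) * (η x ^ 2 * g (u x)) with hJdef
  have hLam0 : 0 ≤ Lam := hlam.le.trans hLam
  have hTS : ∫ x in S, T x = ∫ x in U, T x := by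
    refine (setIntegral_eq_of_subset_of_forall_sdiff_eq_zero hU.measurableSet hSU
      fun x hx => ?_).symm
    by_cases hb : x ∈ Metric.ball x₀ r
    · have : u x ≤ k := not_lt.1 fun h => hx.2 ⟨hb, h⟩
      simp [hTdef, hgk _ this, hg'k _ this]
    · simp [hTdef, hηr x hb]
  have hle : ∀ᵐ x ∂(volume.restrict S), J x ≤ T x + 2 * Lam * H ^ 2 * L ^ 2 := by
    rw [ae_restrict_iff' hSm]
    filter_upwards [hA.2] with x hx hxS
    obtain ⟨hsymm, hell⟩ := hx
    have hk : k < u x := hxS.2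
    have huH : u x - k ≤ H := by linarith [hH x hxS.1]
    have hH0 : 0 ≤ H := by linarith
    have hpos : ∀ ξ : Rn n, 0 ≤ inner ℝ (Matrix.toEuclideanLin (A x) ξ) ξ := fun ξ =>
      (by positivity : 0 ≤ lam * ‖ξ‖ ^ 2).trans (hell ξ).1
    have hgH : g (u x) ≤ deriv g (u x) * H := (hgg _ hk.le).trans
      (mul_le_mul_of_nonneg_left huH (hg'0 _))
    -- Writing `g = g' q` with `0 ≤ q ≤ H` pulls the factor `g'` out of the cross term. Where `g' =
    -- 0`, also `g = 0`, and `q = 0` serves.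
    obtain ⟨q, hq0, hqH, hq⟩ : ∃ q, 0 ≤ q ∧ q ≤ H ∧ g (u x) = deriv g (u x) * q := by
      rcases (hg'0 (u x)).eq_or_lt with h | h
      · refine ⟨0, le_rfl, hH0, ?_⟩
        rw [← h, zero_mul] at hgH ⊢
        exact le_antisymm hgH (hg0 _)
      · exact ⟨g (u x) / deriv g (u x), div_nonneg (hg0 _) h.le, (div_le_iff₀' h).2 hgH,
          (mul_div_cancel₀ _ h.ne').symm⟩
    -- The weight `2 * q` makes the cross term cost exactly half of the energy, which explains the
    -- factor `lam / 2` in `J`.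
    have h1 := neg_two_mul_inner_le hsymm hpos (η x) (2 * q) (Du x) (gradient η x)
    have h2 : q ^ 2 * inner ℝ (Matrix.toEuclideanLin (A x) (gradient η x)) (gradient η x) ≤
        H ^ 2 * (Lam * L ^ 2) := by
      refine mul_le_mul (by gcongr) ((hell _).2.trans ?_) (hpos _) (by positivity)
      gcongr
      exact hηL x
    have h3 := mul_le_mul_of_nonneg_left (hell (Du x)).1 (sq_nonneg (η x))
    have h4 : deriv g (u x) * (H ^ 2 * (Lam * L ^ 2)) ≤ 1 * (H ^ 2 * (Lam * L ^ 2)) := by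
      gcongr
      exact hg'1 _
    have h5 := mul_le_mul_of_nonneg_left h1 (hg'0 (u x))
    have h6 := mul_le_mul_of_nonneg_left h2 (hg'0 (u x))
    have h7 := mul_le_mul_of_nonneg_left h3 (hg'0 (u x))
    simp only [hJdef, hTdef]
    rw [hq]
    linarith
  have hJ0 : ∀ x, 0 ≤ J x := fun x => by
    have := hf0 (u x); have := hg0 (u x); have := hg'0 (u x)
    positivity
  have hub : IntegrableOn (fun x => T x + 2 * Lam * H ^ 2 * L ^ 2) S :=
    (hTi.mono_set hSU).add (integrableOn_const hSfin)
  have hJm : AEStronglyMeasurable J (volume.restrict S) := by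
    have hDu : AEStronglyMeasurable Du (volume.restrict S) :=
      hW.2.1.aestronglyMeasurable.mono_measure (Measure.restrict_mono_set _ hSU)
    have hηc := hη.1.continuous
    have hgc := hg.continuous
    have hg'c : Continuous (deriv g) := hg.continuous_deriv (by simp)
    have c1 : Continuous fun x => η x ^ 2 * deriv g (u x) := by fun_prop
    have c2 : Continuous fun x => η x ^ 2 * g (u x) := by fun_prop
    exact ((c1.aestronglyMeasurable.mul (hDu.norm.pow 2)).const_mul (lam / 2)).add
      ((hf.measurable.comp hu.measurable).aestronglyMeasurable.mul c2.aestronglyMeasurable)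
  have hJi : IntegrableOn J S := hub.mono' hJm (hle.mono fun x hx => by
    rwa [Real.norm_of_nonneg (hJ0 x)])
  refine ⟨hJi, ?_⟩
  calc ∫ x in S, J x ≤ ∫ x in S, (T x + 2 * Lam * H ^ 2 * L ^ 2) :=
        integral_mono_ae hJi hub hle
    _ = (∫ x in U, T x) + 2 * Lam * H ^ 2 * L ^ 2 * (volume S).toReal := by
        rw [integral_add (hTi.mono_set hSU) (integrableOn_const hSfin), hTS]
        simp [Measure.real, mul_comm]
    _ ≤ _ := by linarith

/-! ### Sobolev inequality -/

/-- Dimension one is separate because the Sobolev exponent `n / (n - 1)` degenerates. The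
fundamental theorem of calculus gives the sup bound, after identifying `Rn 1` with the line by the
isometry `γ`. -/
lemma enorm_le_lintegral_enorm_fderiv_of_dim_one {W : Rn 1 → ℝ} (hW : ContDiff ℝ 1 W)
    (hWs : HasCompactSupport W) (x : Rn 1) : ‖W x‖ₑ ≤ ∫⁻ y, ‖fderiv ℝ W y‖ₑ := by
  let e : Rn 1 := WithLp.toLp 2 fun _ => 1
  have he : ‖e‖ = 1 := by simp [e, EuclideanSpace.norm_eq]
  let γ : ℝ → Rn 1 := fun t => t • e
  have hγ : MeasurePreserving γ volume volume := by
    have h := (PiLp.volume_preserving_toLp (Fin 1)).comp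
      (volume_preserving_funUnique (Fin 1) ℝ).symm
    have hγ' : γ = WithLp.toLp 2 ∘ (MeasurableEquiv.funUnique (Fin 1) ℝ).symm := by
      funext t
      ext i
      simp [γ, e, MeasurableEquiv.funUnique]
    rw [hγ']
    exact h
  have hγi : Isometry γ := Isometry.of_dist_eq fun s t => by
    simp only [γ, dist_eq_norm, ← sub_smul, norm_smul, he, mul_one]
  have hγx : γ (x 0) = x := by
    ext i
    fin_cases i
    simp [γ, e]
  have hγd : ∀ t, HasDerivAt γ e t := fun t => by
    simpa using (hasDerivAt_id t).smul_const e
  have hγc : ContDiff ℝ 1 γ := contDiff_id.smul contDiff_const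
  have hd : ∀ t, deriv (W ∘ γ) t = fderiv ℝ W (γ t) e := fun t =>
    (((hW.differentiable one_ne_zero) (γ t)).hasFDerivAt.comp_hasDerivAt t (hγd t)).deriv
  have h := HasCompactSupport.enorm_le_lintegral_Ici_deriv (hW.comp hγc)
    (hWs.comp_isClosedEmbedding hγi.isClosedEmbedding) (x 0)
  rw [Function.comp_apply, hγx] at h
  refine h.trans ((lintegral_mono' Measure.restrict_le_self le_rfl).trans ?_)
  rw [← hγ.lintegral_comp (hW.continuous_fderiv one_ne_zero).enorm.measurable]
  refine lintegral_mono fun t => ?_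
  rw [hd]
  refine enorm_le_iff_norm_le.2 ((ContinuousLinearMap.le_opNorm _ _).trans_eq ?_)
  rw [he, mul_one]

/-- The Sobolev inequality in `W^{1,1}`, combined with Hölder's inequality on a set containing the
support. -/
lemma exists_sobolev_const (hn : n ≠ 0) : ∃ C : ℝ≥0, ∀ (W : Rn n → ℝ) (S : Set (Rn n)),
    ContDiff ℝ 1 W → HasCompactSupport W → (∀ x ∉ S, W x = 0) →
    ∫⁻ x, ‖W x‖ₑ ≤ C * volume S ^ (1 / (n : ℝ)) * ∫⁻ x, ‖fderiv ℝ W x‖ₑ := by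
  have hres : ∀ (W : Rn n → ℝ) (S : Set (Rn n)), (∀ x ∉ S, W x = 0) →
      Function.support W ⊆ S := fun W S h x hx => by
    by_contra hxS
    exact hx (h x hxS)
  rcases eq_or_ne n 1 with rfl | hn1
  · refine ⟨1, fun W S hW hWs hS => ?_⟩
    have h1 : ∀ x, ‖W x‖ₑ ≤ ∫⁻ y, ‖fderiv ℝ W y‖ₑ :=
      enorm_le_lintegral_enorm_fderiv_of_dim_one hW hWs
    calc ∫⁻ x, ‖W x‖ₑ = ∫⁻ x in S, ‖W x‖ₑ := by
          rw [← eLpNorm_one_eq_lintegral_enorm, ← eLpNorm_one_eq_lintegral_enorm,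
            eLpNorm_restrict_eq_of_support_subset (hres W S hS)]
      _ ≤ ∫⁻ _ in S, ∫⁻ y, ‖fderiv ℝ W y‖ₑ := lintegral_mono h1
      _ = _ := by simp [mul_comm]
  · have hn2 : (1 : ℝ) < n := by
      have : 2 ≤ n := by omega
      exact_mod_cast this
    -- The Sobolev exponent for `W^{1,1}`; Hölder on `S` then contributes the power `1 - 1 / p = 1 /
    -- n` of the volume.
    let p : ℝ≥0 := Real.toNNReal (n / (n - 1) : ℝ)
    have hp : (p : ℝ) = n / (n - 1) := Real.coe_toNNReal _ (div_nonneg (by linarith) (by linarith))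
    have hp1 : (1 : ℝ) < p := by
      rw [hp, lt_div_iff₀ (by linarith)]; linarith
    have hconj : NNReal.HolderConjugate (Module.finrank ℝ (Rn n)) p := by
      rw [← NNReal.holderConjugate_coe_iff, hp]
      simp only [finrank_euclideanSpace, Fintype.card_fin, NNReal.coe_natCast]
      exact Real.HolderConjugate.conjExponent hn2
    refine ⟨eLpNormLESNormFDerivOneConst (volume : Measure (Rn n)) p, fun W S hW hWs hS => ?_⟩
    have h1 := eLpNorm_le_eLpNorm_fderiv_one volume hW hWs hconj
    have h2 := eLpNorm_le_eLpNorm_mul_rpow_measure_univ (μ := volume.restrict S) (p := 1)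
      (q := (p : ℝ≥0∞)) (by exact_mod_cast hp1.le) (f := W) hW.continuous.aestronglyMeasurable
    rw [eLpNorm_restrict_eq_of_support_subset (hres W S hS),
      eLpNorm_restrict_eq_of_support_subset (hres W S hS), Measure.restrict_apply_univ,
      ENNReal.toReal_one, ENNReal.coe_toReal, hp] at h2
    have h3 : (1 / 1 - 1 / (n / (n - 1)) : ℝ) = 1 / n := by
      have : (n : ℝ) ≠ 0 := by positivity
      field_simp
      ring
    rw [h3] at h2
    rw [eLpNorm_one_eq_lintegral_enorm] at h1 h2
    calc ∫⁻ x, ‖W x‖ₑ ≤ eLpNorm W p volume * volume S ^ (1 / (n : ℝ)) := h2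
      _ ≤ (eLpNormLESNormFDerivOneConst (volume : Measure (Rn n)) p * ∫⁻ x, ‖fderiv ℝ W x‖ₑ) *
          volume S ^ (1 / (n : ℝ)) := by gcongr
      _ = _ := by ring

lemma integral_abs_le_of_sobolev {C : ℝ≥0}
    (hC : ∀ (W : Rn n → ℝ) (S : Set (Rn n)),
      ContDiff ℝ 1 W → HasCompactSupport W → (∀ x ∉ S, W x = 0) →
      ∫⁻ x, ‖W x‖ₑ ≤ C * volume S ^ (1 / (n : ℝ)) * ∫⁻ x, ‖fderiv ℝ W x‖ₑ)
    {W : Rn n → ℝ} {S : Set (Rn n)} (hW : ContDiff ℝ ∞ W) (hWs : HasCompactSupport W)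
    (hS : ∀ x ∉ S, W x = 0) (hSfin : volume S ≠ ⊤) :
    ∫ x, |W x| ≤ C * (volume S).toReal ^ (1 / (n : ℝ)) * ∫ x, ‖gradient W x‖ := by
  have h := hC W S (hW.of_le (by exact_mod_cast le_top)) hWs hS
  have hW' : ContDiff ℝ 1 W := hW.of_le (by exact_mod_cast le_top)
  have hi : Integrable (fun x => fderiv ℝ W x) :=
    (hW'.continuous_fderiv one_ne_zero).integrable_of_hasCompactSupport (hWs.fderiv ℝ)
  simp only [norm_gradient, ← Real.norm_eq_abs]
  rw [integral_norm_eq_lintegral_enorm hW.continuous.aestronglyMeasurable,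
    integral_norm_eq_lintegral_enorm hi.aestronglyMeasurable, ENNReal.toReal_rpow,
    ← ENNReal.coe_toReal C, ← ENNReal.toReal_mul, ← ENNReal.toReal_mul]
  refine ENNReal.toReal_mono ?_ h
  exact ENNReal.mul_ne_top (ENNReal.mul_ne_top ENNReal.coe_ne_top
    (ENNReal.rpow_ne_top_of_nonneg (by positivity) hSfin)) hi.2.ne

/-- The Sobolev inequality for `η g(u)`. -/
lemma sobolev_truncation {C : ℝ≥0}
    (hC : ∀ (W : Rn n → ℝ) (S : Set (Rn n)),
      ContDiff ℝ 1 W → HasCompactSupport W → (∀ x ∉ S, W x = 0) →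
      ∫⁻ x, ‖W x‖ₑ ≤ C * volume S ^ (1 / (n : ℝ)) * ∫⁻ x, ‖fderiv ℝ W x‖ₑ)
    {U : Set (Rn n)} (hU : IsOpen U)
    {u : Rn n → ℝ} (hu : Continuous u) {Du : Rn n → Rn n} (hW : MemW12 U u Du)
    {η : Rn n → ℝ} (hη : IsTest U η) (hη0 : ∀ x, 0 ≤ η x)
    {g : ℝ → ℝ} {k k' : ℝ} (hk : k' < k) (hg : ContDiff ℝ ∞ g) (hg0 : ∀ s, 0 ≤ g s)
    (hg'0 : ∀ s, 0 ≤ deriv g s) (hg'1 : ∀ s, deriv g s ≤ 1) (hgk : ∀ s ≤ k, g s = 0)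
    {S : Set (Rn n)} (hS : ∀ x, η x ≠ 0 → k' < u x → x ∈ S) (hSfin : volume S ≠ ⊤) :
    ∫ x in U, η x * g (u x) ≤ C * (volume S).toReal ^ (1 / (n : ℝ)) *
      ∫ x in U, (g (u x) * ‖gradient η x‖ + η x * deriv g (u x) * ‖Du x‖) := by
  set μ := volume.restrict U with hμ
  set K := tsupport η with hK
  have hKc : IsCompact K := hη.2.1
  have hDη : MemLp (gradient η) 1 μ := hη.memLp_gradient.restrict _
  obtain ⟨w, hwd, hwu, hwD⟩ := exists_smooth_approx hU hu hW hKc hη.2.2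
  have hηK : ∀ x, x ∉ K → η x = 0 := fun x hx => image_eq_zero_of_notMem_tsupport hx
  have hDηK : ∀ x, x ∉ K → gradient η x = 0 := fun x hx => gradient_eq_zero_of_notMem_tsupport hx
  obtain ⟨m, hm⟩ := hKc.exists_bound_of_continuousOn hu.continuousOn
  obtain ⟨G, hG⟩ := (isCompact_Icc (a := -(m + 1)) (b := m + 1)).exists_bound_of_continuousOn
    hg.continuous.continuousOn
  have hgc : Continuous g := hg.continuous
  have hg'c : Continuous (deriv g) := hg.continuous_deriv (by simp)
  have hηc : Continuous η := hη.1.continuous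
  have hηi : Integrable η μ := (hηc.integrable_of_hasCompactSupport hη.2.1).restrict
  have hη2 : MemLp η 2 μ := (hηc.memLp_of_hasCompactSupport hη.2.1).restrict _
  let P : (Rn n → ℝ) → Rn n → ℝ := fun v x =>
    g (v x) * ‖gradient η x‖ + η x * deriv g (v x) * ‖Du x‖
  let Q : ℕ → Rn n → ℝ := fun j x => η x * ‖gradient (w j) x - Du x‖
  have hPm : ∀ v, Continuous v → AEStronglyMeasurable (P v) μ := fun v hv => by
    have c2 : Continuous fun x => η x * deriv g (v x) := by fun_prop
    exact ((hgc.comp hv).aestronglyMeasurable.mul hDη.aestronglyMeasurable.norm).add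
      (c2.aestronglyMeasurable.mul hW.2.1.aestronglyMeasurable.norm)
  let bound : Rn n → ℝ := fun x => G * ‖gradient η x‖ + η x * ‖Du x‖
  have hbound : Integrable bound μ :=
    ((memLp_one_iff_integrable.1 hDη).norm.const_mul G).add
      (hη2.integrable_mul hW.2.1.norm)
  have hgle : ∀ v : Rn n → ℝ, (∀ x ∈ K, |v x - u x| ≤ 1) → ∀ x ∈ K, g (v x) ≤ G := by
    intro v hv x hx
    have h1 := abs_le.1 (hv x hx)
    have h2 := abs_le.1 (hm x hx)
    exact (le_abs_self _).trans (hG _ ⟨by linarith, by linarith⟩)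
  have hPle : ∀ v : Rn n → ℝ, (∀ x ∈ K, |v x - u x| ≤ 1) → ∀ x, ‖P v x‖ ≤ bound x := by
    intro v hv x
    have hP0 : 0 ≤ P v x := add_nonneg (mul_nonneg (hg0 _) (norm_nonneg _))
      (mul_nonneg (mul_nonneg (hη0 x) (hg'0 _)) (norm_nonneg _))
    rw [Real.norm_of_nonneg hP0]
    by_cases hx : x ∈ K
    · refine add_le_add (mul_le_mul_of_nonneg_right (hgle v hv x hx) (norm_nonneg _))
        (mul_le_mul_of_nonneg_right ?_ (norm_nonneg _))
      exact mul_le_of_le_one_right (hη0 x) (hg'1 _)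
    · simp [P, bound, hηK x hx, hDηK x hx]
  have hev := hwu 1 one_pos
  have hwx : ∀ x ∈ K, Tendsto (fun j => w j x) atTop (𝓝 (u x)) := fun x hx => by
    rw [Metric.tendsto_nhds]
    intro ε hε
    filter_upwards [hwu (ε / 2) (half_pos hε)] with j hj
    rw [Real.dist_eq]
    linarith [hj x hx]
  have hPint' : ∀ᶠ j in atTop, Integrable (P (w j)) μ := hev.mono fun j hj =>
    hbound.mono' (hPm _ (hwd j).continuous) (ae_of_all _ (hPle _ hj))
  have hPlim : Tendsto (fun j => ∫ x, P (w j) x ∂μ) atTop (𝓝 (∫ x, P u x ∂μ)) := by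
    refine tendsto_integral_filter_of_dominated_convergence bound
      (Eventually.of_forall fun j => hPm _ (hwd j).continuous)
      (hev.mono fun j hj => ae_of_all _ (hPle _ hj)) hbound (ae_of_all _ fun x => ?_)
    by_cases hx : x ∈ K
    · have t1 := (hgc.tendsto _).comp (hwx x hx)
      have t2 := (hg'c.tendsto _).comp (hwx x hx)
      exact (t1.mul_const _).add ((t2.const_mul _).mul_const _)
    · simp [P, hηK x hx, hDηK x hx]
  have hLlim : Tendsto (fun j => ∫ x, η x * g (w j x) ∂μ) atTop (𝓝 (∫ x, η x * g (u x) ∂μ)) := by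
    refine tendsto_integral_filter_of_dominated_convergence (fun x => η x * G)
      (Eventually.of_forall fun j => (hηc.mul (hgc.comp (hwd j).continuous)).aestronglyMeasurable)
      (hev.mono fun j hj => ae_of_all _ fun x => ?_) (hηi.mul_const G) (ae_of_all _ fun x => ?_)
    · rw [Real.norm_of_nonneg (mul_nonneg (hη0 x) (hg0 _))]
      by_cases hx : x ∈ K
      · exact mul_le_mul_of_nonneg_left (hgle _ hj x hx) (hη0 x)
      · simp [hηK x hx]
    · by_cases hx : x ∈ K
      · exact ((hgc.tendsto _).comp (hwx x hx)).const_mul _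
      · simp [hηK x hx]
  have hDm : ∀ j, AEStronglyMeasurable (fun x => gradient (w j) x - Du x) (volume.restrict K) :=
    fun j => (continuous_gradient (hwd j)).aestronglyMeasurable.sub
      (hW.2.1.aestronglyMeasurable.mono_measure (Measure.restrict_mono_set _ hη.2.2))
  have hL := tendsto_integral_norm_mul_of_eLpNorm
    (hη2.mono_measure (Measure.restrict_mono_set _ hη.2.2)) hDm hwD
  have hQeq : ∀ j, ∫⁻ x, ‖Q j x‖ₑ ∂μ = ∫⁻ x in K, ‖η x‖ₑ * ‖gradient (w j) x - Du x‖ₑ := fun j => by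
    have hKU : K ∩ U = K := inter_eq_self_of_subset_left hη.2.2
    calc ∫⁻ x, ‖Q j x‖ₑ ∂μ
        = ∫⁻ x, K.indicator (fun x => ‖η x‖ₑ * ‖gradient (w j) x - Du x‖ₑ) x ∂μ := by
          refine lintegral_congr fun x => ?_
          by_cases hx : x ∈ K
          · simp [hx, Q]
          · simp [hx, Q, hηK x hx]
      _ = ∫⁻ x in K, ‖η x‖ₑ * ‖gradient (w j) x - Du x‖ₑ := by
          rw [hμ, setLIntegral_indicator hKc.measurableSet, hKU]
  have hQlim : Tendsto (fun j => ∫ x, Q j x ∂μ) atTop (𝓝 0) := by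
    rw [tendsto_zero_iff_enorm_tendsto_zero]
    exact tendsto_of_tendsto_of_tendsto_of_le_of_le tendsto_const_nhds hL (fun _ => zero_le)
      fun j => (enorm_integral_le_lintegral_enorm _).trans (hQeq j).le
  have hQint : ∀ᶠ j in atTop, Integrable (Q j) μ := by
    filter_upwards [hL.eventually_lt_const ENNReal.zero_lt_top] with j hj
    exact ⟨hηc.aestronglyMeasurable.mul ((continuous_gradient (hwd j)).aestronglyMeasurable.sub
      hW.2.1.aestronglyMeasurable).norm, (hQeq j).trans_lt hj⟩
  have hlim := (hPlim.add hQlim).const_mul (C * (volume S).toReal ^ (1 / (n : ℝ)))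
  rw [add_zero] at hlim
  refine le_of_tendsto_of_tendsto hLlim hlim ?_
  -- The gap `k' < k` absorbs the approximation error: where `η ≠ 0` and `w j > k`, one has `u >
  -- k'`, so the approximants also vanish off `S`.
  filter_upwards [hPint', hQint, hwu (k - k') (sub_pos.2 hk)] with j hP hQ hj
  let W : Rn n → ℝ := fun y => η y * g (w j y)
  have hWt : IsTest U W :=
    ⟨hη.1.mul (hg.comp (hwd j)), hη.2.1.mul_right, tsupport_mul_subset_left.trans hη.2.2⟩
  have hWS : ∀ x ∉ S, W x = 0 := fun x hx => by
    by_contra hne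
    have hηx : η x ≠ 0 := left_ne_zero_of_mul hne
    have hgx : k < w j x := by
      by_contra h
      exact hne (by simp [W, hgk _ (not_lt.1 h)])
    have := (abs_le.1 (hj x (subset_tsupport η hηx))).2
    exact hx (hS x hηx (by linarith))
  have hmain := integral_abs_le_of_sobolev hC hWt.1 hWt.2.1 hWS hSfin
  have e1 : ∫ x, |W x| = ∫ x, η x * g (w j x) ∂μ := by
    rw [hμ, setIntegral_eq_integral_of_forall_compl_eq_zero fun x hx => by
      rw [hηK x fun h => hx (hη.2.2 h), zero_mul]]
    exact integral_congr_ae (ae_of_all _ fun x => abs_of_nonneg (mul_nonneg (hη0 x) (hg0 _)))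
  have e2 : ∫ x, ‖gradient W x‖ = ∫ x, ‖gradient W x‖ ∂μ := by
    rw [hμ, setIntegral_eq_integral_of_forall_compl_eq_zero fun x hx => by
      rw [gradient_eq_zero_of_notMem_tsupport fun h => hx (hWt.2.2 h), norm_zero]]
  rw [e1, e2] at hmain
  refine hmain.trans (mul_le_mul_of_nonneg_left ?_ (by positivity))
  rw [← integral_add hP hQ]
  refine integral_mono (memLp_one_iff_integrable.1 (hWt.memLp_gradient.restrict _)).norm
    (hP.add hQ) fun x => ?_
  simp only [W, P, Q, gradient_mul_comp hη.1 (hwd j) hg]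
  have h1 : ‖gradient (w j) x‖ ≤ ‖Du x‖ + ‖gradient (w j) x - Du x‖ := by
    simpa using norm_add_le (Du x) (gradient (w j) x - Du x)
  have h2 : 0 ≤ η x * deriv g (w j x) := mul_nonneg (hη0 x) (hg'0 _)
  refine (norm_add_le _ _).trans ?_
  rw [norm_smul, norm_smul, Real.norm_of_nonneg (hg0 _), Real.norm_of_nonneg h2]
  have h3 := mul_le_mul_of_nonneg_left h1 h2
  have h4 : η x * deriv g (w j x) * ‖gradient (w j) x - Du x‖ ≤
      η x * ‖gradient (w j) x - Du x‖ :=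
    mul_le_mul_of_nonneg_right (mul_le_of_le_one_right (hη0 x) (hg'1 _)) (norm_nonneg _)
  linarith

/-! ### Superlevel sets and De Giorgi's iteration -/

lemma isTest_of_ball {U : Set (Rn n)} {η : Rn n → ℝ} (hη : ContDiff ℝ ∞ η) {x₀ : Rn n} {r : ℝ}
    (hηr : ∀ y ∉ Metric.ball x₀ r, η y = 0) (hU : Metric.closedBall x₀ r ⊆ U) : IsTest U η := by
  have hsub : tsupport η ⊆ Metric.closedBall x₀ r := by
    refine closure_minimal (fun y hy => ?_) Metric.isClosed_closedBall
    by_contra h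
    exact hy (hηr y fun hb => h (Metric.ball_subset_closedBall hb))
  exact ⟨hη, (isCompact_closedBall _ _).of_isClosed_subset (isClosed_tsupport _) hsub,
    hsub.trans hU⟩

/-- The volume of the superlevel set `{u > k}` in a ball. -/
noncomputable def levelVol (u : Rn n → ℝ) (x₀ : Rn n) (r k : ℝ) : ℝ :=
  (volume (Metric.ball x₀ r ∩ {y | k < u y})).toReal

lemma volume_level_ne_top (u : Rn n → ℝ) (x₀ : Rn n) (r k : ℝ) :
    volume (Metric.ball x₀ r ∩ {y | k < u y}) ≠ ⊤ :=
  ((measure_mono inter_subset_left).trans_lt Metric.isBounded_ball.measure_lt_top).ne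

lemma levelVol_nonneg (u : Rn n → ℝ) (x₀ : Rn n) (r k : ℝ) : 0 ≤ levelVol u x₀ r k :=
  ENNReal.toReal_nonneg

lemma levelVol_mono (u : Rn n → ℝ) (x₀ : Rn n) {ρ r k l : ℝ} (hr : ρ ≤ r) (hk : k ≤ l) :
    levelVol u x₀ ρ l ≤ levelVol u x₀ r k :=
  ENNReal.toReal_mono (volume_level_ne_top u x₀ r k) (measure_mono
    (inter_subset_inter (Metric.ball_subset_ball hr) fun _ hy => lt_of_le_of_lt hk hy))

lemma measurableSet_level {u : Rn n → ℝ} (hu : Continuous u) (x₀ : Rn n) (r k : ℝ) :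
    MeasurableSet (Metric.ball x₀ r ∩ {y | k < u y}) :=
  (Metric.isOpen_ball.inter (isOpen_lt continuous_const hu)).measurableSet

lemma mul_levelVol_le_setIntegral {u : Rn n → ℝ} (hu : Continuous u) {x₀ : Rn n} {ρ l c : ℝ}
    {S : Set (Rn n)} {J : Rn n → ℝ} (hJ : IntegrableOn J S)
    (hJ0 : ∀ y, 0 ≤ J y) (hsub : Metric.ball x₀ ρ ∩ {y | l < u y} ⊆ S)
    (hc : ∀ y ∈ Metric.ball x₀ ρ, l < u y → c ≤ J y) :
    c * levelVol u x₀ ρ l ≤ ∫ y in S, J y := by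
  calc c * levelVol u x₀ ρ l = ∫ _ in Metric.ball x₀ ρ ∩ {y | l < u y}, c := by
        simp [levelVol, Measure.real, mul_comm]
    _ ≤ ∫ y in Metric.ball x₀ ρ ∩ {y | l < u y}, J y :=
        setIntegral_mono_on (integrableOn_const (volume_level_ne_top u x₀ ρ l))
          (hJ.mono_set hsub) (measurableSet_level hu x₀ ρ l) fun y hy => hc y hy.1 hy.2
    _ ≤ ∫ y in S, J y := setIntegral_mono_set hJ (ae_of_all _ hJ0) hsub.eventuallyLE

/-- The right-hand side of the equation bounds the measure of superlevel sets. -/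
lemma exists_levelVol_rhs_bound {A : Rn n → Matrix (Fin n) (Fin n) ℝ} {lam Lam : ℝ}
    (hlam : 0 < lam) (hLam : lam ≤ Lam) (hA : IsUniformlyElliptic A lam Lam)
    {f : ℝ → ℝ} (hf0 : ∀ t, 0 ≤ f t) (hf : Monotone f)
    {u : Rn n → ℝ} (hu : Continuous u) (hsub : IsEntireSubsolution A f u) :
    ∃ C : ℝ, 0 < C ∧ ∀ (x₀ : Rn n) (ρ r k l H : ℝ), 0 < ρ → ρ < r → k < l →
      (∀ y ∈ Metric.ball x₀ r, u y ≤ k + H) →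
      f k * (l - k) * levelVol u x₀ ρ l ≤ C * (H / (r - ρ)) ^ 2 * levelVol u x₀ r k := by
  obtain ⟨C, hC0, hC⟩ := exists_cutoff
  have hLam0 : 0 < Lam := hlam.trans_le hLam
  refine ⟨4 * Lam * C ^ 2, by positivity, fun x₀ ρ r k l H hρ hr hkl hH => ?_⟩
  obtain ⟨η, hηd, hη0, hη1, hηρ, hηr, hηL⟩ := hC n x₀ ρ r hρ hr
  have hUr : Metric.closedBall x₀ r ⊆ Metric.ball x₀ (r + 1) :=
    Metric.closedBall_subset_ball (by linarith)
  obtain ⟨Du, hW, htest⟩ := hsub (Metric.ball x₀ (r + 1)) Metric.isOpen_ball Metric.isBounded_ball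
  -- Smoothing width `(l - k) / 2` leaves `g(u) ≥ (l - k) / 2` on `{u > l}`.
  obtain ⟨g, hg, hg0, hg'0, hg'1, hgk, hg'k, hgg, hgε⟩ :=
    exists_smooth_truncation k (half_pos (sub_pos.2 hkl))
  obtain ⟨hi, hle⟩ := caccioppoli hlam hLam hA hf0 hf Metric.isOpen_ball hu hW htest
    (isTest_of_ball hηd hηr hUr) hη0 hη1 (Metric.ball_subset_closedBall.trans hUr) hηr hηL hg hg0
    hg'0 hg'1 hgk hg'k hgg hH
  have hlow := mul_levelVol_le_setIntegral (x₀ := x₀) (ρ := ρ) (l := l)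
    (c := f k * ((l - k) / 2)) hu hi
    (fun y => by
      have := hf0 (u y); have := hg0 (u y); have := hg'0 (u y)
      positivity)
    (inter_subset_inter (Metric.ball_subset_ball hr.le) fun _ hy => hkl.trans hy)
    (fun y hy hly => by
      have h1 : (l - k) / 2 ≤ g (u y) := by linarith [hgε (u y)]
      have h2 : f k ≤ f (u y) := hf (hkl.trans hly).le
      have h3 : 0 ≤ lam / 2 * (η y ^ 2 * deriv g (u y) * ‖Du y‖ ^ 2) := by
        have := hg'0 (u y)
        positivity
      have h4 : f k * ((l - k) / 2) ≤ f (u y) * g (u y) :=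
        mul_le_mul h2 h1 (by linarith) (hf0 _)
      rw [hηρ y hy] at h3 ⊢
      linarith)
  have h := hlow.trans hle
  rw [← levelVol] at h
  rw [div_pow] at h ⊢
  have e : 4 * Lam * C ^ 2 * (H ^ 2 / (r - ρ) ^ 2) * levelVol u x₀ r k =
      2 * (2 * Lam * H ^ 2 * (C ^ 2 / (r - ρ) ^ 2) * levelVol u x₀ r k) := by ring
  rw [e]
  linarith

/-- One step of De Giorgi's iteration. -/
lemma exists_levelVol_step {A : Rn n → Matrix (Fin n) (Fin n) ℝ} {lam Lam : ℝ} (hn : n ≠ 0)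
    (hlam : 0 < lam) (hLam : lam ≤ Lam) (hA : IsUniformlyElliptic A lam Lam)
    {f : ℝ → ℝ} (hf0 : ∀ t, 0 ≤ f t) (hf : Monotone f)
    {u : Rn n → ℝ} (hu : Continuous u) (hsub : IsEntireSubsolution A f u) :
    ∃ C : ℝ, 0 < C ∧ ∀ (x₀ : Rn n) (ρ r k l H : ℝ), 0 < ρ → ρ < r → k < l → 0 < H →
      (∀ y ∈ Metric.ball x₀ r, u y ≤ k + H) →
      (l - k) * levelVol u x₀ ρ l ≤
        C * (H / (r - ρ)) * (levelVol u x₀ r k * levelVol u x₀ r k ^ (1 / (n : ℝ))) := by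
  obtain ⟨C, hC0, hC⟩ := exists_cutoff
  obtain ⟨Cs, hCs⟩ := exists_sobolev_const hn
  have hLam0 : 0 < Lam := hlam.trans_le hLam
  refine ⟨4 * (Cs + 1) * C * (3 / 2 + 2 * Lam / lam), by positivity,
    fun x₀ ρ r k l H hρ hr hkl hH0 hH => ?_⟩
  obtain ⟨η, hηd, hη0, hη1, hηρ, hηr, hηL⟩ := hC n x₀ ρ r hρ hr
  have hUr : Metric.closedBall x₀ r ⊆ Metric.ball x₀ (r + 1) :=
    Metric.closedBall_subset_ball (by linarith)
  have hbU : Metric.ball x₀ r ⊆ Metric.ball x₀ (r + 1) := Metric.ball_subset_closedBall.trans hUr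
  set U := Metric.ball x₀ (r + 1) with hUdef
  have hηt : IsTest U η := isTest_of_ball hηd hηr hUr
  obtain ⟨Du, hW, htest⟩ := hsub U Metric.isOpen_ball Metric.isBounded_ball
  -- Truncating at the midpoint leaves the gap `k < k₁` that `sobolev_truncation` needs; smoothing
  -- width `(l - k) / 4` still gives `g(u) ≥ (l - k) / 4` on `{u > l}`.
  set k₁ := k + (l - k) / 2 with hk₁
  have hkk₁ : k < k₁ := by linarith
  have hk₁l : k₁ < l := by linarith
  obtain ⟨g, hg, hg0, hg'0, hg'1, hgk, hg'k, hgg, hgε⟩ :=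
    exists_smooth_truncation k₁ (ε := (l - k) / 4) (by linarith)
  obtain ⟨hi, hle⟩ := caccioppoli hlam hLam hA hf0 hf Metric.isOpen_ball hu hW htest
    hηt hη0 hη1 hbU hηr hηL hg hg0 hg'0 hg'1 hgk hg'k hgg
    (H := H) (fun y hy => by linarith [hH y hy])
  rw [← levelVol] at hle
  have hsob := sobolev_truncation hCs Metric.isOpen_ball hu hW hηt hη0 hkk₁ hg hg0 hg'0 hg'1
    hgk (S := Metric.ball x₀ r ∩ {y | k < u y})
    (fun x hx hkx => ⟨by_contra fun h => hx (hηr x h), hkx⟩) (volume_level_ne_top u x₀ r k)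
  rw [← levelVol] at hsob
  set s := levelVol u x₀ r k with hs
  have hs0 : 0 ≤ s := levelVol_nonneg _ _ _ _
  set S₁ := Metric.ball x₀ r ∩ {y | k₁ < u y} with hS₁
  have hs₁ : levelVol u x₀ r k₁ ≤ s := levelVol_mono u x₀ le_rfl hkk₁.le
  set L := C / (r - ρ) with hL
  have hL0 : 0 < L := div_pos hC0 (by linarith)
  set τ := H * L with hτ
  have hτ0 : 0 < τ := by positivity
  have hηc : Continuous η := hηd.continuous
  have hlow := mul_levelVol_le_setIntegral (x₀ := x₀) (ρ := ρ) (l := l)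
    (S := U) (c := (l - k) / 4) hu
    (J := fun x => η x * g (u x))
    ((hηc.mul (hg.continuous.comp hu)).integrable_of_hasCompactSupport
      hηt.2.1.mul_right).integrableOn
    (fun y => mul_nonneg (hη0 y) (hg0 _))
    (inter_subset_left.trans ((Metric.ball_subset_ball hr.le).trans hbU))
    (fun y hy hly => by
      show (l - k) / 4 ≤ η y * g (u y)
      rw [hηρ y hy, one_mul]
      linarith [hgε (u y)])
  have hS₁m : MeasurableSet S₁ := measurableSet_level hu x₀ r k₁
  have hright : ∫ x in U, (g (u x) * ‖gradient η x‖ + η x * deriv g (u x) * ‖Du x‖) ≤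
      (3 / 2 + 2 * Lam / lam) * τ * s := by
    have e1 : ∫ x in U, (g (u x) * ‖gradient η x‖ + η x * deriv g (u x) * ‖Du x‖) =
        ∫ x in S₁, (g (u x) * ‖gradient η x‖ + η x * deriv g (u x) * ‖Du x‖) := by
      refine setIntegral_eq_of_subset_of_forall_sdiff_eq_zero Metric.isOpen_ball.measurableSet
        (inter_subset_left.trans hbU) fun x hx => ?_
      by_cases hb : x ∈ Metric.ball x₀ r
      · have : u x ≤ k₁ := not_lt.1 fun h => hx.2 ⟨hb, h⟩
        simp [hgk _ this, hg'k _ this]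
      · by_cases hux : u x ≤ k₁
        · simp [hgk _ hux, hg'k _ hux]
        · have h0 : gradient η x = 0 := by
            have hmin : IsLocalMin η x := Eventually.of_forall fun y => by
              rw [hηr x hb]; exact hη0 y
            simp [gradient, hmin.fderiv_eq_zero]
          simp [hηr x hb, h0]
    rw [e1]
    set J : Rn n → ℝ := fun x => lam / 2 * (η x ^ 2 * deriv g (u x) * ‖Du x‖ ^ 2) +
      f (u x) * (η x ^ 2 * g (u x)) with hJ
    have hbd : ∀ x ∈ S₁, g (u x) * ‖gradient η x‖ + η x * deriv g (u x) * ‖Du x‖ ≤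
        3 / 2 * τ + 1 / (lam * τ) * J x := by
      intro x hx
      have hk : k₁ < u x := hx.2
      have hgH : g (u x) ≤ H := (hgg _ hk.le).trans ((mul_le_mul (hg'1 _)
        (by linarith [hH x hx.1] : u x - k₁ ≤ H) (by linarith) zero_le_one).trans_eq (one_mul H))
      have h1 : g (u x) * ‖gradient η x‖ ≤ τ := mul_le_mul hgH (hηL x) (norm_nonneg _) hH0.le
      -- Young's inequality at the scale `τ = H * L`, so that integrating against the Caccioppoli
      -- bound, of order `τ²`, leaves a single power of `τ`.
      have h2 : η x * deriv g (u x) * ‖Du x‖ ≤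
          τ / 2 + 1 / (lam * τ) * (lam / 2 * (η x ^ 2 * deriv g (u x) * ‖Du x‖ ^ 2)) := by
        have e2 : 1 / (lam * τ) * (lam / 2 * (η x ^ 2 * deriv g (u x) * ‖Du x‖ ^ 2)) =
            deriv g (u x) * (η x * ‖Du x‖) ^ 2 / (2 * τ) := by
          field_simp
        rw [e2, ← sub_le_iff_le_add', le_div_iff₀ (by positivity)]
        have hd0 := hg'0 (u x)
        have hd1 := hg'1 (u x)
        nlinarith [mul_nonneg hd0 (sq_nonneg (η x * ‖Du x‖ - τ)),
          mul_nonneg (sub_nonneg.2 hd1) (sq_nonneg τ)]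
      have h3 : 0 ≤ 1 / (lam * τ) * (f (u x) * (η x ^ 2 * g (u x))) := by
        have := hf0 (u x); have := hg0 (u x)
        positivity
      simp only [hJ, mul_add]
      linarith
    have hfin : volume S₁ ≠ ⊤ := volume_level_ne_top u x₀ r k₁
    have hi2 : IntegrableOn (fun x => 3 / 2 * τ + 1 / (lam * τ) * J x) S₁ :=
      (integrableOn_const hfin).add (hi.const_mul _)
    have hle2 : ∫ x in S₁, (g (u x) * ‖gradient η x‖ + η x * deriv g (u x) * ‖Du x‖) ≤
        ∫ x in S₁, (3 / 2 * τ + 1 / (lam * τ) * J x) :=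
      integral_mono_of_nonneg (ae_of_all _ fun x => add_nonneg (mul_nonneg (hg0 _) (norm_nonneg _))
        (mul_nonneg (mul_nonneg (hη0 x) (hg'0 _)) (norm_nonneg _))) hi2
        ((ae_restrict_iff' hS₁m).2 (ae_of_all _ hbd))
    refine hle2.trans ?_
    have hci : IntegrableOn (fun _ : Rn n => 3 / 2 * τ) S₁ := integrableOn_const hfin
    have e3 : ∫ _ in S₁, 3 / 2 * τ = 3 / 2 * τ * levelVol u x₀ r k₁ := by
      simp [levelVol, Measure.real, mul_comm, hS₁]
    rw [integral_add hci (hi.const_mul _), e3, integral_const_mul]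
    have h4 : 1 / (lam * τ) * ∫ x in S₁, J x ≤ 1 / (lam * τ) * (2 * Lam * H ^ 2 * L ^ 2 * s) := by
      refine mul_le_mul_of_nonneg_left (hle.trans ?_) (by positivity)
      gcongr
    have h5 : 1 / (lam * τ) * (2 * Lam * H ^ 2 * L ^ 2 * s) = 2 * Lam / lam * τ * s := by
      rw [hτ]; field_simp
    have h6 : 3 / 2 * τ * levelVol u x₀ r k₁ ≤ 3 / 2 * τ * s := by gcongr
    rw [h5] at h4
    linarith
  have hfinal := hlow.trans (hsob.trans (mul_le_mul_of_nonneg_left hright (by positivity)))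
  have h7 : (Cs : ℝ) * s ^ (1 / (n : ℝ)) * ((3 / 2 + 2 * Lam / lam) * τ * s) ≤
      (Cs + 1) * s ^ (1 / (n : ℝ)) * ((3 / 2 + 2 * Lam / lam) * τ * s) := by
    gcongr
    linarith
  have e8 : 4 * (Cs + 1) * C * (3 / 2 + 2 * Lam / lam) * (H / (r - ρ)) * (s * s ^ (1 / (n : ℝ))) =
      4 * ((Cs + 1) * s ^ (1 / (n : ℝ)) * ((3 / 2 + 2 * Lam / lam) * τ * s)) := by
    rw [hτ, hL]; ring
  rw [e8]
  linarith

/-- Geometric decay with ratio `q = 4⁻ⁿ` propagates: the extra factor `a i ^ (1 / n)` contributes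
`4⁻ⁱ`, which cancels the growing `4 ^ i`, and the smallness of `a 0` supplies the next factor `q`.
-/
lemma tendsto_zero_of_superlinear_recursion (hn : n ≠ 0) {a : ℕ → ℝ} {D : ℝ}
    (ha : ∀ i, 0 ≤ a i) (hD : 0 ≤ D)
    (hstep : ∀ i, a (i + 1) ≤ D * 4 ^ i * (a i * a i ^ (1 / (n : ℝ))))
    (h0 : D * a 0 ^ (1 / (n : ℝ)) ≤ (1 / 4) ^ n) : Tendsto a atTop (𝓝 0) := by
  have hn0 : (0 : ℝ) < n := by positivity
  set q : ℝ := (1 / 4) ^ n with hq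
  have hq0 : 0 < q := by positivity
  have hq1 : q < 1 := pow_lt_one₀ (by norm_num) (by norm_num) hn
  have hqn : ∀ i : ℕ, (q ^ i) ^ (1 / (n : ℝ)) = (1 / 4) ^ i := fun i => by
    rw [hq, ← pow_mul, mul_comm, pow_mul, ← Real.rpow_natCast (((1 : ℝ) / 4) ^ i) n,
      ← Real.rpow_mul (by positivity), mul_one_div_cancel hn0.ne', Real.rpow_one]
  have hle : ∀ i, a i ≤ a 0 * q ^ i := by
    intro i
    induction i with
    | zero => simp
    | succ i ih =>
      have hpos : 0 ≤ a 0 * q ^ i := mul_nonneg (ha 0) (by positivity)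
      have h1 : a i ^ (1 / (n : ℝ)) ≤ a 0 ^ (1 / (n : ℝ)) * (1 / 4) ^ i := by
        rw [← hqn, ← Real.mul_rpow (ha 0) (by positivity)]
        exact Real.rpow_le_rpow (ha i) ih (by positivity)
      have h2 : a i * a i ^ (1 / (n : ℝ)) ≤
          (a 0 * q ^ i) * (a 0 ^ (1 / (n : ℝ)) * (1 / 4) ^ i) :=
        mul_le_mul ih h1 (Real.rpow_nonneg (ha i) _) hpos
      calc a (i + 1) ≤ D * 4 ^ i * (a i * a i ^ (1 / (n : ℝ))) := hstep i
        _ ≤ D * 4 ^ i * ((a 0 * q ^ i) * (a 0 ^ (1 / (n : ℝ)) * (1 / 4) ^ i)) := by gcongr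
        _ = (D * a 0 ^ (1 / (n : ℝ))) * (a 0 * q ^ i) * (4 ^ i * (1 / 4) ^ i) := by ring
        _ = (D * a 0 ^ (1 / (n : ℝ))) * (a 0 * q ^ i) := by
          rw [← mul_pow]; norm_num
        _ ≤ q * (a 0 * q ^ i) := by gcongr
        _ = a 0 * q ^ (i + 1) := by ring
  have hlim : Tendsto (fun i => a 0 * q ^ i) atTop (𝓝 0) := by
    simpa using (tendsto_pow_atTop_nhds_zero_of_lt_one hq0.le hq1).const_mul (a 0)
  exact squeeze_zero ha hle hlim

/-- A subsolution bounded by `M` in a ball lies well below `M` at the centre, if the right-hand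
side is large. -/
lemma exists_growth_const {A : Rn n → Matrix (Fin n) (Fin n) ℝ} {lam Lam : ℝ} (hn : n ≠ 0)
    (hlam : 0 < lam) (hLam : lam ≤ Lam) (hA : IsUniformlyElliptic A lam Lam)
    {f : ℝ → ℝ} (hf0 : ∀ t, 0 ≤ f t) (hf : Monotone f)
    {u : Rn n → ℝ} (hu : Continuous u) (hsub : IsEntireSubsolution A f u) :
    ∃ K : ℝ, 0 < K ∧ ∀ (x₀ : Rn n) (δ h M : ℝ), 0 < δ → 0 < h →
      (∀ y ∈ Metric.ball x₀ δ, u y ≤ M) → K * h ≤ f (M - h) * δ ^ 2 → u x₀ ≤ M - h / 4 := by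
  have hn0 : (0 : ℝ) < n := by positivity
  obtain ⟨C₁, hC₁, hrhs⟩ := exists_levelVol_rhs_bound hlam hLam hA hf0 hf hu hsub
  obtain ⟨C₂, hC₂, hstep⟩ := exists_levelVol_step hn hlam hLam hA hf0 hf hu hsub
  set v₀ : ℝ := (volume (Metric.ball (0 : Rn n) 1)).toReal with hv
  have hv0 : 0 < v₀ := ENNReal.toReal_pos
    (Metric.measure_ball_pos volume _ one_pos).ne' Metric.isBounded_ball.measure_lt_top.ne
  have hvol : ∀ (x₀ : Rn n) (δ k : ℝ), 0 < δ → levelVol u x₀ δ k ≤ v₀ * δ ^ n := by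
    intro x₀ δ k hδ
    have h1 : volume (Metric.ball x₀ δ) = ENNReal.ofReal (δ ^ n) * volume (Metric.ball (0 : Rn n) 1)
        := by simpa using Measure.addHaar_ball_of_pos (volume : Measure (Rn n)) x₀ hδ
    have h2 : levelVol u x₀ δ k ≤ (volume (Metric.ball x₀ δ)).toReal :=
      ENNReal.toReal_mono Metric.isBounded_ball.measure_lt_top.ne (measure_mono inter_subset_left)
    rwa [h1, ENNReal.toReal_mul, ENNReal.toReal_ofReal (by positivity), mul_comm] at h2
  -- The constant `c` below is chosen so that `a 0 ≤ (δ / c) ^ n` is the smallness required to start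
  -- the recursion with `D = 32 * C₂ / δ`; this `K` makes the term with `f` deliver it.
  refine ⟨8 * C₁ * v₀ * (32 * C₂ * 4 ^ n) ^ n, by positivity, fun x₀ δ h M hδ hh hM hK => ?_⟩
  set c : ℝ := 32 * C₂ * 4 ^ n with hc
  have hc0 : 0 < c := by positivity
  -- Levels rise from `M - h / 2` towards `M - h / 4` while radii shrink from `δ / 2` towards `δ /
  -- 4`. Both increments decay like `2⁻ⁱ`, whence the `4 ^ i`.
  let k : ℕ → ℝ := fun i => M - h / 2 + h / 4 * (1 - (1 / 2) ^ i)
  let r : ℕ → ℝ := fun i => δ / 4 + δ / 4 * (1 / 2) ^ i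
  let a : ℕ → ℝ := fun i => levelVol u x₀ (r i) (k i)
  have hhalf : ∀ i : ℕ, (0 : ℝ) < (1 / 2) ^ i := fun i => by positivity
  have hhalf1 : ∀ i : ℕ, ((1 : ℝ) / 2) ^ i ≤ 1 := fun i =>
    pow_le_one₀ (by norm_num) (by norm_num)
  have hrδ : ∀ i, r i ≤ δ := fun i => by
    have := mul_le_mul_of_nonneg_left (hhalf1 i) (by positivity : 0 ≤ δ / 4)
    simp only [r]; linarith
  have hk0 : ∀ i, M - h / 2 ≤ k i := fun i => by
    have := mul_nonneg (by positivity : 0 ≤ h / 4) (sub_nonneg.2 (hhalf1 i))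
    simp only [k]; linarith
  have hk1 : ∀ i, k i ≤ M - h / 4 := fun i => by
    have := mul_pos (by positivity : 0 < h / 4) (hhalf i)
    simp only [k]; linarith
  have hr1 : ∀ i, δ / 4 ≤ r i := fun i => by
    have := mul_pos (by positivity : 0 < δ / 4) (hhalf i)
    simp only [r]; linarith
  have hks : ∀ i, k (i + 1) - k i = h / 8 * (1 / 2) ^ i := fun i => by
    simp only [k, pow_succ]; ring
  have hrs : ∀ i, r i - r (i + 1) = δ / 8 * (1 / 2) ^ i := fun i => by
    simp only [r, pow_succ]; ring
  have ha : ∀ i, a (i + 1) ≤ 32 * C₂ / δ * 4 ^ i * (a i * a i ^ (1 / (n : ℝ))) := by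
    intro i
    have hp1 : 0 < h / 8 * (1 / 2) ^ i := by positivity
    have hp2 : 0 < δ / 8 * (1 / 2) ^ i := by positivity
    have h1 := hstep x₀ (r (i + 1)) (r i) (k i) (k (i + 1)) (h / 2)
      (by linarith [hr1 (i + 1)]) (by linarith [hrs i]) (by linarith [hks i]) (by positivity)
      (fun y hy => by linarith [hM y (Metric.ball_subset_ball (hrδ i) hy), hk0 i])
    rw [hks, hrs] at h1
    have h2 : a (i + 1) ≤ (C₂ * (h / 2 / (δ / 8 * (1 / 2) ^ i)) * (a i * a i ^ (1 / (n : ℝ)))) /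
        (h / 8 * (1 / 2) ^ i) := by
      rw [le_div_iff₀' hp1]; exact h1
    refine h2.trans_eq ?_
    have h4 : (4 : ℝ) ^ i = 2 ^ i * 2 ^ i := by rw [← mul_pow]; norm_num
    rw [h4, one_div_pow]
    field_simp
    ring
  have ha0 : a 0 ≤ (δ / c) ^ n := by
    have h1 := hrhs x₀ (r 0) δ (M - h) (k 0) h (by linarith [hr1 0])
      (by simp only [r, pow_zero]; linarith) (by linarith [hk0 0])
      (fun y hy => by linarith [hM y hy])
    have e1 : k 0 = M - h / 2 := by simp [k]
    have e2 : r 0 = δ / 2 := by simp only [r, pow_zero]; ring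
    have e3 : δ - r 0 = δ / 2 := by rw [e2]; ring
    have e4 : k 0 - (M - h) = h / 2 := by rw [e1]; ring
    rw [e3, e4] at h1
    have hKh : 0 < 8 * C₁ * v₀ * c ^ n * h := by positivity
    have hfpos : 0 < f (M - h) := by
      by_contra hneg
      have : f (M - h) * δ ^ 2 ≤ 0 := mul_nonpos_of_nonpos_of_nonneg (not_lt.1 hneg) (by positivity)
      linarith
    have h2 : f (M - h) * (h / 2) * a 0 ≤ C₁ * (h / (δ / 2)) ^ 2 * (v₀ * δ ^ n) :=
      h1.trans (mul_le_mul_of_nonneg_left (hvol x₀ δ _ hδ) (by positivity))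
    have h3 : f (M - h) * δ ^ 2 * a 0 ≤ 8 * C₁ * h * (v₀ * δ ^ n) := by
      have := mul_le_mul_of_nonneg_left h2 (by positivity : 0 ≤ 2 * δ ^ 2 / h)
      calc f (M - h) * δ ^ 2 * a 0 = 2 * δ ^ 2 / h * (f (M - h) * (h / 2) * a 0) := by field_simp
        _ ≤ _ := this
        _ = _ := by field_simp; norm_num
    have h4 : 8 * C₁ * v₀ * c ^ n * h * a 0 ≤ 8 * C₁ * h * (v₀ * δ ^ n) :=
      (mul_le_mul_of_nonneg_right hK (levelVol_nonneg _ _ _ _)).trans h3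
    rw [div_pow, le_div_iff₀ (by positivity)]
    have hpos : 0 < 8 * C₁ * h * v₀ := by positivity
    refine le_of_mul_le_mul_left ?_ hpos
    linarith
  have hlim : Tendsto a atTop (𝓝 0) := by
    refine tendsto_zero_of_superlinear_recursion hn (fun i => levelVol_nonneg _ _ _ _)
      (by positivity) ha ?_
    have h1 : a 0 ^ (1 / (n : ℝ)) ≤ δ / c := by
      have := Real.rpow_le_rpow (levelVol_nonneg _ _ _ _) ha0 (by positivity : 0 ≤ 1 / (n : ℝ))
      rwa [← Real.rpow_natCast, ← Real.rpow_mul (by positivity), mul_one_div_cancel hn0.ne',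
        Real.rpow_one] at this
    calc 32 * C₂ / δ * a 0 ^ (1 / (n : ℝ)) ≤ 32 * C₂ / δ * (δ / c) := by gcongr
      _ = (1 / 4) ^ n := by rw [hc, one_div_pow]; field_simp
  -- Otherwise, by continuity, `{u > M - h / 4}` has positive measure in the ball of radius `δ / 4`,
  -- and this measure bounds every `a i` from below.
  by_contra hcon
  rw [not_le] at hcon
  have hopen : IsOpen (Metric.ball x₀ (δ / 4) ∩ {y | M - h / 4 < u y}) :=
    Metric.isOpen_ball.inter (isOpen_lt continuous_const hu)
  have hpos : 0 < levelVol u x₀ (δ / 4) (M - h / 4) :=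
    ENNReal.toReal_pos (hopen.measure_pos volume
      ⟨x₀, Metric.mem_ball_self (by positivity), hcon⟩).ne' (volume_level_ne_top _ _ _ _)
  have hle := ge_of_tendsto hlim (Eventually.of_forall fun i =>
    levelVol_mono u x₀ (hr1 i) (hk1 i))
  linarith

/-! ### The integral function -/

variable {f : ℝ → ℝ}

lemma integralFunction_sub (hf : Monotone f) (s t : ℝ) :
    integralFunction f t - integralFunction f s = ∫ τ in s..t, f τ :=
  intervalIntegral.integral_interval_sub_left hf.intervalIntegrable hf.intervalIntegrable

lemma mul_le_integralFunction_sub (hf : Monotone f) {s t : ℝ} (hst : s ≤ t) :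
    f s * (t - s) ≤ integralFunction f t - integralFunction f s := by
  rw [integralFunction_sub hf]
  calc f s * (t - s) = ∫ _ in s..t, f s := by simp [mul_comm]
    _ ≤ _ := intervalIntegral.integral_mono_on hst intervalIntegrable_const hf.intervalIntegrable
      fun τ hτ => hf hτ.1

lemma integralFunction_sub_le_mul (hf : Monotone f) {s t : ℝ} (hst : s ≤ t) :
    integralFunction f t - integralFunction f s ≤ f t * (t - s) := by
  rw [integralFunction_sub hf]
  calc _ ≤ ∫ _ in s..t, f t := intervalIntegral.integral_mono_on hst hf.intervalIntegrable
        intervalIntegrable_const fun τ hτ => hf hτ.2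
    _ = f t * (t - s) := by simp [mul_comm]

lemma monotone_integralFunction (hf0 : ∀ t, 0 ≤ f t) (hf : Monotone f) :
    Monotone (integralFunction f) := fun s t hst => by
  have := mul_le_integralFunction_sub hf hst
  have := mul_nonneg (hf0 s) (sub_nonneg.2 hst)
  linarith

lemma continuous_integralFunction (hf : Monotone f) : Continuous (integralFunction f) :=
  intervalIntegral.continuous_primitive (fun _ _ => hf.intervalIntegrable) 0

lemma strictMonoOn_integralFunction (hf : Monotone f) {b : ℝ} (hfb : ∀ t, b < t → 0 < f t) :
    StrictMonoOn (integralFunction f) (Ici b) := fun s hs t _ hst => by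
  rw [← sub_pos, integralFunction_sub hf]
  exact intervalIntegral.intervalIntegral_pos_of_pos_on hf.intervalIntegrable
    (fun τ hτ => hfb τ (lt_of_le_of_lt hs hτ.1)) hst

lemma tendsto_integralFunction (hf : Monotone f) {b : ℝ} (hfb : 0 < f b) :
    Tendsto (integralFunction f) atTop atTop := by
  have h : Tendsto (fun t => integralFunction f b + f b * (t - b)) atTop atTop :=
    tendsto_atTop_add_const_left _ _
      ((tendsto_atTop_add_const_right _ (-b) tendsto_id).const_mul_atTop hfb)
  refine tendsto_atTop_mono' _ ?_ h
  filter_upwards [eventually_ge_atTop b] with t ht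
  linarith [mul_le_integralFunction_sub hf ht]

/-! ### Climbing through levels and the Keller–Osserman integral -/

lemma invSqrt_anti {y z : ℝ} (h : y ≤ z) : invSqrt z ≤ invSqrt y :=
  ENNReal.inv_le_inv.2 (ENNReal.ofReal_le_ofReal (Real.sqrt_le_sqrt h))

lemma invSqrt_sq {y : ℝ} (hy : 0 < y) : invSqrt (y ^ 2) = ENNReal.ofReal y⁻¹ := by
  rw [invSqrt, Real.sqrt_sq hy.le, ENNReal.ofReal_inv_of_pos hy]

/-- Levels at which `F - F(b)` grows geometrically, starting at a prescribed third level. -/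
lemma exists_levels (hf : Monotone f) {b v : ℝ} (hfb : ∀ t, b < t → 0 < f t) (hv : b < v) :
    ∃ (γ : ℝ) (t : ℕ → ℝ), 0 < γ ∧ (∀ k, b < t k) ∧ StrictMono t ∧ t 2 = v ∧
      ∀ k, integralFunction f (t k) - integralFunction f b = (2 ^ k * γ) ^ 2 := by
  set F := integralFunction f with hF
  have hmono := strictMonoOn_integralFunction hf hfb
  have hpos : 0 < F v - F b := sub_pos.2 (hmono self_mem_Ici hv.le hv)
  -- The divisor 4 is `2 ^ 2`, so that the level of index 2 is `v`. Two levels remain between `b`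
  -- and `v`, as the first climb needs.
  set γ := Real.sqrt (F v - F b) / 4 with hγ
  have hγ0 : 0 < γ := div_pos (Real.sqrt_pos.2 hpos) (by norm_num)
  have hlim := tendsto_integralFunction hf (hfb (b + 1) (by linarith))
  have hex : ∀ k : ℕ, ∃ t, b < t ∧ F t - F b = (2 ^ k * γ) ^ 2 := by
    intro k
    have hk : 0 < (2 ^ k * γ) ^ 2 := by positivity
    obtain ⟨T, hT1, hT2⟩ :=
      ((hlim.eventually_ge_atTop (F b + (2 ^ k * γ) ^ 2)).and (eventually_ge_atTop b)).exists
    obtain ⟨t, ht, hFt⟩ := intermediate_value_Icc hT2 (continuous_integralFunction hf).continuousOn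
      ⟨by linarith, hT1⟩
    refine ⟨t, lt_of_le_of_ne ht.1 fun h => ?_, by linarith⟩
    rw [← h] at hFt
    linarith
  choose t htb ht using hex
  refine ⟨γ, t, hγ0, htb, strictMono_nat_of_lt_succ fun k => ?_, ?_, ht⟩
  · refine (hmono.lt_iff_lt (htb k).le (htb (k + 1)).le).1 ?_
    have h1 := ht k
    have h2 := ht (k + 1)
    have h3 : (2 ^ k * γ) ^ 2 < (2 ^ (k + 1) * γ) ^ 2 := by
      gcongr
      · norm_num
      · omega
    linarith
  · refine hmono.injOn (htb 2).le hv.le ?_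
    have h1 := ht 2
    have h2 : (2 ^ 2 * γ) ^ 2 = F v - F b := by
      rw [hγ]
      have := Real.sq_sqrt hpos.le
      linarith
    linarith

/-- A subsolution reaching a level reaches a higher level nearby. -/
lemma exists_reach {u : Rn n → ℝ} (hu : Continuous u) (hf : Monotone f) {K : ℝ}
    (hK : ∀ (x₀ : Rn n) (δ h M : ℝ), 0 < δ → 0 < h →
      (∀ y ∈ Metric.ball x₀ δ, u y ≤ M) → K * h ≤ f (M - h) * δ ^ 2 → u x₀ ≤ M - h / 4)
    {x₀ x : Rn n} {R t h δ : ℝ} (hδ : 0 < δ) (hh : 0 < h) (hx : dist x x₀ ≤ R) (ht : t ≤ u x)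
    (hKf : K * h ≤ f (t - h) * δ ^ 2) : ∃ y, dist y x₀ ≤ R + δ ∧ t + h / 4 ≤ u y := by
  -- The growth estimate is applied with `M = u y`, the maximum over the closed ball. Since `M ≥ t`,
  -- the condition at `t - h` passes to `M - h` by monotonicity of `f`.
  obtain ⟨y, hy, hmax⟩ := (isCompact_closedBall x δ).exists_isMaxOn
    ⟨x, Metric.mem_closedBall_self hδ.le⟩ hu.continuousOn
  refine ⟨y, ?_, ?_⟩
  · have := dist_triangle y x x₀
    have := Metric.mem_closedBall.1 hy
    linarith
  · have hxy : u x ≤ u y := hmax (Metric.mem_closedBall_self hδ.le)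
    have hf' : f (t - h) ≤ f (u y - h) := hf (by linarith)
    have := hK x δ h (u y) hδ hh (fun z hz => hmax (Metric.ball_subset_closedBall hz))
      (hKf.trans (mul_le_mul_of_nonneg_right hf' (sq_nonneg δ)))
    linarith

/-- The condition on `f` only improves at higher levels, so the same `h` and `δ` serve for every
step. -/
lemma exists_reach_iterate {u : Rn n → ℝ} (hu : Continuous u) (hf : Monotone f) {K : ℝ}
    (hK : ∀ (x₀ : Rn n) (δ h M : ℝ), 0 < δ → 0 < h →
      (∀ y ∈ Metric.ball x₀ δ, u y ≤ M) → K * h ≤ f (M - h) * δ ^ 2 → u x₀ ≤ M - h / 4)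
    {x₀ x : Rn n} {R t h δ : ℝ} (hδ : 0 < δ) (hh : 0 < h) (hx : dist x x₀ ≤ R) (ht : t ≤ u x)
    (hKf : K * h ≤ f (t - h) * δ ^ 2) (j : ℕ) :
    ∃ y, dist y x₀ ≤ R + j * δ ∧ t + j * (h / 4) ≤ u y := by
  induction j with
  | zero => exact ⟨x, by simpa using hx, by simpa using ht⟩
  | succ j ih =>
    obtain ⟨y, hy, hty⟩ := ih
    have hle : t - h ≤ t + j * (h / 4) - h := by
      have : (0 : ℝ) ≤ j * (h / 4) := by positivity
      linarith
    obtain ⟨z, hz, htz⟩ := exists_reach hu hf hK hδ hh hy hty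
      (hKf.trans (mul_le_mul_of_nonneg_right (hf hle) (sq_nonneg δ)))
    refine ⟨z, ?_, ?_⟩ <;> push_cast <;> linarith

/-- The Keller–Osserman integral of an entire subsolution diverges at infinity. -/
theorem lintegral_invSqrt_eq_top_of_pos {A : Rn n → Matrix (Fin n) (Fin n) ℝ} {lam Lam : ℝ}
    (hn : n ≠ 0) (hlam : 0 < lam) (hLam : lam ≤ Lam) (hA : IsUniformlyElliptic A lam Lam)
    (hf0 : ∀ t, 0 ≤ f t) (hf : Monotone f)
    {u : Rn n → ℝ} (hu : Continuous u) (hsub : IsEntireSubsolution A f u)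
    {b : ℝ} (hfb : ∀ t, b < t → 0 < f t) {x₀ : Rn n} (hx₀ : b < u x₀) (T : ℝ) :
    ∫⁻ t in Ioi T, invSqrt (integralFunction f t - integralFunction f b) = ⊤ := by
  obtain ⟨K, hK0, hK⟩ := exists_growth_const hn hlam hLam hA hf0 hf hu hsub
  obtain ⟨γ, t, hγ, htb, htm, ht2, ht⟩ := exists_levels hf hfb hx₀
  set F := integralFunction f with hF
  let σ : ℕ → ℝ := fun k => t (k + 1) - t k
  have hσ : ∀ k, 0 < σ k := fun k => sub_pos.2 (htm (Nat.lt_succ_self k))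
  have hG : ∀ k, F (t (k + 1)) - F (t k) = 3 * 4 ^ k * γ ^ 2 := fun k => by
    have h1 := ht k
    have h2 := ht (k + 1)
    have h4 : (4 : ℝ) ^ k = 2 ^ k * 2 ^ k := by rw [← mul_pow]; norm_num
    rw [pow_succ (2 : ℝ) k] at h2
    rw [h4]
    linarith
  have hfσ : ∀ k, 3 * 4 ^ k * γ ^ 2 ≤ f (t (k + 1)) * σ k := fun k =>
    (hG k).symm.trans_le (integralFunction_sub_le_mul hf (htm (Nat.lt_succ_self k)).le)
  -- The average of `f` over the next gap is at least `f (t (k + 1))`, which is at least its average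
  -- over the previous gap, while the increment of `F` is multiplied by 4.
  have hσ4 : ∀ k, σ (k + 1) ≤ 4 * σ k := fun k => by
    have h1 := hfσ k
    have h2 : f (t (k + 1)) * σ (k + 1) ≤ 3 * 4 ^ (k + 1) * γ ^ 2 :=
      (mul_le_integralFunction_sub hf (htm (Nat.lt_succ_self (k + 1))).le).trans_eq (hG (k + 1))
    refine le_of_mul_le_mul_left ?_ (hfb _ (htb (k + 1)))
    rw [pow_succ] at h2
    linarith
  -- The growth condition requires a radius of order `2⁻ᵏ √(σ k * σ (k + 1))`; the sum dominates
  -- this geometric mean and is comparable with the terms of `∑ 2⁻ᵏ σ k`.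
  let τ : ℕ → ℝ := fun k => (1 / 2) ^ k * (σ k + σ (k + 1))
  have hτ : ∀ k, 0 < τ k := fun k => mul_pos (by positivity) (add_pos (hσ _) (hσ _))
  -- Adding 1 gives `B ≤ B ^ 2`, so `K / γ ^ 2 ≤ B ^ 2` without a square root.
  set B : ℝ := K / γ ^ 2 + 1 with hB
  have hB1 : 1 ≤ B := by
    have : 0 < K / γ ^ 2 := by positivity
    linarith
  have hBK : K ≤ B ^ 2 * γ ^ 2 := by
    have h1 : K / γ ^ 2 ≤ B ^ 2 := by nlinarith
    rwa [div_le_iff₀ (by positivity)] at h1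
  have hreach : ∀ k, ∃ y, dist y x₀ ≤ ∑ i ∈ Finset.range k, 16 * (B * τ i) ∧ t (k + 2) ≤ u y := by
    intro k
    induction k with
    | zero => exact ⟨x₀, by simp, ht2.le⟩
    | succ k ih =>
      obtain ⟨y, hy, hty⟩ := ih
      have hstep : K * σ (k + 1) ≤ f (t (k + 2) - σ (k + 1)) * (B * τ k) ^ 2 := by
        have e1 : t (k + 2) - σ (k + 1) = t (k + 1) := by simp only [σ]; ring
        have h1 := hfσ k
        have hk := hσ k
        have hk1 := hσ (k + 1)
        have h4 : ((1 : ℝ) / 2) ^ k * (1 / 2) ^ k * 4 ^ k = 1 := by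
          rw [← mul_pow, ← mul_pow]; norm_num
        have h5 : (B * τ k) ^ 2 * 4 ^ k = B ^ 2 * (σ k + σ (k + 1)) ^ 2 := by
          calc (B * τ k) ^ 2 * 4 ^ k =
              B ^ 2 * (σ k + σ (k + 1)) ^ 2 * ((1 / 2) ^ k * (1 / 2) ^ k * 4 ^ k) := by
                simp only [τ]; ring
            _ = _ := by rw [h4, mul_one]
        rw [e1]
        refine le_of_mul_le_mul_right ?_ hk
        calc K * σ (k + 1) * σ k ≤ B ^ 2 * γ ^ 2 * (σ (k + 1) * σ k) := by
              rw [mul_assoc]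
              exact mul_le_mul_of_nonneg_right hBK (by positivity)
          _ ≤ B ^ 2 * γ ^ 2 * (3 * (σ k + σ (k + 1)) ^ 2) := by
              refine mul_le_mul_of_nonneg_left ?_ (by positivity)
              nlinarith
          _ = (B * τ k) ^ 2 * (3 * 4 ^ k * γ ^ 2) := by linear_combination (-3 * γ ^ 2) * h5
          _ ≤ (B * τ k) ^ 2 * (f (t (k + 1)) * σ k) := by gcongr
          _ = _ := by ring
      -- Sixteen climbs by `σ (k + 1) / 4` gain `4 * σ (k + 1) ≥ σ (k + 2)`, enough to reach the
      -- next level.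
      obtain ⟨z, hz, htz⟩ := exists_reach_iterate hu hf hK (mul_pos (by linarith) (hτ k))
        (hσ (k + 1)) hy hty hstep 16
      refine ⟨z, ?_, le_trans ?_ htz⟩
      · rw [Finset.sum_range_succ]
        exact_mod_cast hz
      · have := hσ4 (k + 1)
        have e : t (k + 1 + 2) = t (k + 2) + σ (k + 1 + 1) := by simp only [σ]; ring
        rw [e]
        push_cast
        linarith
  -- Summability would keep all the points reached in one closed ball, where `u` is bounded,
  -- although `F` tends to infinity along the levels.
  have hnot : ¬ Summable fun k => (1 / 2) ^ k * σ k := by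
    intro hs
    have hτs : Summable τ := by
      have h1 : Summable fun k => 2 * ((1 / 2) ^ (k + 1) * σ (k + 1)) :=
        ((summable_nat_add_iff 1).2 hs).mul_left 2
      refine (hs.add h1).congr fun k => ?_
      simp only [τ, pow_succ]; ring
    have hs16 : Summable fun i => 16 * (B * τ i) := (hτs.mul_left B).mul_left 16
    obtain ⟨m, hm⟩ := (isCompact_closedBall x₀ (∑' i, 16 * (B * τ i))).exists_bound_of_continuousOn
      hu.continuousOn
    have hbdd : ∀ k, t (k + 2) ≤ m := fun k => by
      obtain ⟨y, hy, hty⟩ := hreach k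
      have h1 : ∑ i ∈ Finset.range k, 16 * (B * τ i) ≤ ∑' i, 16 * (B * τ i) :=
        hs16.sum_le_tsum _ fun i _ => by have := hτ i; positivity
      exact hty.trans ((le_abs_self _).trans (hm y (Metric.mem_closedBall.2 (hy.trans h1))))
    have hpow : Tendsto (fun k : ℕ => (2 ^ (k + 2) * γ) ^ 2) atTop atTop := by
      have h1 : Tendsto (fun k : ℕ => (2 : ℝ) ^ (k + 2) * γ) atTop atTop :=
        ((tendsto_pow_atTop_atTop_of_one_lt one_lt_two).comp
          (tendsto_add_atTop_nat 2)).atTop_mul_const hγ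
      exact (tendsto_pow_atTop two_ne_zero).comp h1
    obtain ⟨k, hk⟩ := (hpow.eventually_gt_atTop (F m - F b)).exists
    have h1 := monotone_integralFunction hf0 hf (hbdd k)
    have h2 := ht (k + 2)
    linarith
  have hunb : ∃ m, T ≤ t m := by
    by_contra! hcon
    have hpow : Tendsto (fun k : ℕ => (2 ^ k * γ) ^ 2) atTop atTop := by
      have h1 : Tendsto (fun k : ℕ => (2 : ℝ) ^ k * γ) atTop atTop :=
        (tendsto_pow_atTop_atTop_of_one_lt one_lt_two).atTop_mul_const hγ
      exact (tendsto_pow_atTop two_ne_zero).comp h1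
    obtain ⟨k, hk⟩ := (hpow.eventually_gt_atTop (F T - F b)).exists
    have h1 := monotone_integralFunction hf0 hf (hcon k).le
    have h2 := ht k
    linarith
  obtain ⟨m, hm⟩ := hunb
  by_contra hne
  refine hnot ((summable_nat_add_iff m).1 ?_)
  -- On the `k`-th gap `√(F - F b) ≤ 2 ^ (k + 1) * γ`, so the integral over it is at least `2⁻ᵏ σ k
  -- / (2γ)`.
  have hpiece : ∀ k, ENNReal.ofReal ((2 * γ)⁻¹ * ((1 / 2) ^ k * σ k)) ≤
      ∫⁻ s in Ioc (t k) (t (k + 1)), invSqrt (F s - F b) := fun k => by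
    have h1 : ENNReal.ofReal ((2 * γ)⁻¹ * ((1 / 2) ^ k * σ k)) =
        ∫⁻ _ in Ioc (t k) (t (k + 1)), invSqrt ((2 ^ (k + 1) * γ) ^ 2) := by
      rw [invSqrt_sq (by positivity), lintegral_const, Measure.restrict_apply_univ,
        Real.volume_Ioc, ← ENNReal.ofReal_mul (by positivity)]
      congr 1
      simp only [σ, one_div_pow, pow_succ]
      field_simp
    rw [h1]
    refine setLIntegral_mono' measurableSet_Ioc fun s hs => invSqrt_anti ?_
    rw [← ht (k + 1)]
    exact sub_le_sub_right (monotone_integralFunction hf0 hf hs.2) _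
  have hsum : ∑' k, ENNReal.ofReal ((2 * γ)⁻¹ * ((1 / 2) ^ (k + m) * σ (k + m))) ≠ ⊤ := by
    refine ne_top_of_le_ne_top hne ?_
    have hmono' : Monotone fun k => t (k + m) := fun i j hij =>
      htm.monotone (Nat.add_le_add_right hij m)
    calc ∑' k, ENNReal.ofReal ((2 * γ)⁻¹ * ((1 / 2) ^ (k + m) * σ (k + m)))
        ≤ ∑' k, ∫⁻ s in Ioc (t (k + m)) (t (k + 1 + m)), invSqrt (F s - F b) :=
          ENNReal.tsum_le_tsum fun k => by
            have := hpiece (k + m)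
            rwa [show k + m + 1 = k + 1 + m by ring] at this
      _ = ∫⁻ s in ⋃ k, Ioc (t (k + m)) (t (k + 1 + m)), invSqrt (F s - F b) :=
          (lintegral_iUnion (fun _ => measurableSet_Ioc)
            hmono'.pairwise_disjoint_on_Ioc_succ _).symm
      _ ≤ ∫⁻ s in Ioi T, invSqrt (F s - F b) :=
          lintegral_mono_set (iUnion_subset fun k s hs =>
            (hm.trans (htm.monotone (Nat.le_add_left m k))).trans_lt hs.1)
  have hs := ENNReal.summable_toReal hsum
  have hs' : Summable fun k => (2 * γ) * ((2 * γ)⁻¹ * ((1 / 2) ^ (k + m) * σ (k + m))) := by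
    refine (hs.congr fun k => ?_).mul_left _
    exact ENNReal.toReal_ofReal (by have := hσ (k + m); positivity)
  refine hs'.congr fun k => ?_
  rw [← mul_assoc, mul_inv_cancel₀ (by positivity), one_mul]

end DivForm

/-! ### Both forms of the Keller–Osserman condition -/

theorem corollary4p4 {n : ℕ} {lam Lam : ℝ} (hlam : 0 < lam) (hLam : lam ≤ Lam)
    (A : DivForm.Rn n → Matrix (Fin n) (Fin n) ℝ)
    (hA : DivForm.IsUniformlyElliptic A lam Lam)
    (f : ℝ → ℝ) (hf_nonneg : ∀ t, 0 ≤ f t) (hf_mono : Monotone f)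
    (u : DivForm.Rn n → ℝ) (hu_cont : Continuous u)
    (hu_sub : DivForm.IsEntireSubsolution A f u)
    (hu_nonconst : ∃ x y, u x ≠ u y) :
    (∀ b : ℝ, (∃ x, b < u x) →
      ∫⁻ t in Ioi b, DivForm.invSqrt
        (DivForm.integralFunction f t - DivForm.integralFunction f b) = (⊤ : ℝ≥0∞)) ∧
    ((∃ t₀ : ℝ, 0 < f t₀ ∧ ∃ x, t₀ < u x) →
      ∀ a : ℝ, 0 ≤ a → ∫⁻ t in Ioi a, DivForm.invSqrt (DivForm.integralFunction f t) = (⊤ : ℝ≥0∞)) := by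
  -- Nonconstancy serves to exclude the one-point space, where the Sobolev argument is meaningless.
  have hn : n ≠ 0 := by
    rintro rfl
    obtain ⟨x, y, hxy⟩ := hu_nonconst
    exact hxy (by rw [Subsingleton.elim x y])
  refine ⟨?_, ?_⟩
  · rintro b ⟨x, hx⟩
    by_cases hfb : ∀ t, b < t → 0 < f t
    · exact DivForm.lintegral_invSqrt_eq_top_of_pos hn hlam hLam hA hf_nonneg hf_mono hu_cont hu_sub
        hfb hx b
    · push Not at hfb
      obtain ⟨c, hbc, hc⟩ := hfb
      have hc0 : f c = 0 := le_antisymm hc (hf_nonneg c)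
      -- By monotonicity `f` vanishes on `(b, c]`, so `F` does not grow there and the integrand is
      -- infinite on a set of positive measure.
      refine top_unique ?_
      calc (⊤ : ℝ≥0∞) = ∫⁻ _ in Ioc b c, (⊤ : ℝ≥0∞) := by
            rw [lintegral_const, Measure.restrict_apply_univ, Real.volume_Ioc, ENNReal.top_mul]
            simpa using hbc
        _ ≤ ∫⁻ t in Ioc b c, DivForm.invSqrt
              (DivForm.integralFunction f t - DivForm.integralFunction f b) := by
            refine setLIntegral_mono' measurableSet_Ioc fun t ht => ?_
            have h1 := DivForm.integralFunction_sub_le_mul hf_mono ht.1.le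
            have h2 : f t = 0 := le_antisymm ((hf_mono ht.2).trans_eq hc0) (hf_nonneg t)
            rw [h2, zero_mul] at h1
            refine le_trans ?_ (DivForm.invSqrt_anti h1)
            simp [DivForm.invSqrt]
        _ ≤ _ := lintegral_mono_set Ioc_subset_Ioi_self
  · rintro ⟨b, hb, x, hx⟩ a ha
    have hfb : ∀ t, b < t → 0 < f t := fun t ht => hb.trans_le (hf_mono ht.le)
    set F := DivForm.integralFunction f with hF
    -- The threshold `F t ≥ 4 / 3 * F b` is equivalent to `F t / 4 ≤ F t - F b`, so beyond `T` the
    -- two integrands differ by a factor of at most 2 in the needed direction. Divergence on every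
    -- half-line `Ioi T` is what makes this tail comparison suffice.
    obtain ⟨T, hT⟩ := Filter.eventually_atTop.1
      ((DivForm.tendsto_integralFunction hf_mono hb).eventually_ge_atTop (4 / 3 * F b))
    have htop := DivForm.lintegral_invSqrt_eq_top_of_pos hn hlam hLam hA hf_nonneg hf_mono hu_cont
      hu_sub hfb hx (max a T)
    have hle : ∀ t ∈ Ioi (max a T), DivForm.invSqrt (F t - F b) ≤ 2 * DivForm.invSqrt (F t) := by
      intro t ht
      have h1 : F t / 4 ≤ F t - F b := by
        linarith [hT t ((le_max_right a T).trans (le_of_lt ht))]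
      refine (DivForm.invSqrt_anti h1).trans_eq ?_
      have h2 : Real.sqrt (F t) = 2 * Real.sqrt (F t / 4) := by
        rw [show F t = 2 ^ 2 * (F t / 4) by ring, Real.sqrt_mul (by positivity),
          Real.sqrt_sq (by norm_num)]
        ring_nf
      rw [DivForm.invSqrt, DivForm.invSqrt, h2, ENNReal.ofReal_mul (by norm_num),
        ENNReal.mul_inv (by simp) (by simp), ← mul_assoc]
      simp [ENNReal.mul_inv_cancel]
    have h2 : (2 : ℝ≥0∞) * ∫⁻ t in Ioi (max a T), DivForm.invSqrt (F t) = ⊤ := by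
      rw [← lintegral_const_mul' _ _ (by simp)]
      exact top_unique (htop.symm.trans_le (setLIntegral_mono' measurableSet_Ioi hle))
    have h3 : ∫⁻ t in Ioi (max a T), DivForm.invSqrt (F t) = ⊤ := by
      by_contra hne
      exact ENNReal.mul_ne_top (by simp) hne h2
    exact top_unique (h3.symm.trans_le
      (lintegral_mono_set (Ioi_subset_Ioi (le_max_left a T))))
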